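/- Let $\rho$ be an unknown $n$-qubit density matrix, and for $S\subseteq\{1,\dots,n\}$ let $\rho_S$ be its reduced density matrix on the qubits in $S$. For a family $S_1,\dots,S_M$ of subsets, $\varepsilon>0$ and $\delta\in(0,1)$, a scheme using $m$ copies measures $\rho^{\otimes m}$ by a POVM and, from the outcome, outputs density matrices $\sigma_{S_1},\dots,\sigma_{S_M}$; it succeeds if for every $\rho$, with probability at least $1-\delta$, $\|\rho_{S_i}-\sigma_{S_i}\|_1<\varepsilon$ holds for all $i$ simultaneously ($\|\cdot\|_1$ is the trace norm). The sample complexity is the least $m$ for which a successful scheme exists. In a joint scheme the POVM on the $mn$ qubits is arbitrary (with finitely many outcomes); in a Pauli scheme every qubit of every copy is measured separately in an independent, uniformly random basis among those of $\sigma_X,\sigma_Y,\sigma_Z$, that is, by the POVM $\{(I\pm\sigma_P)/6 : P=X,Y,Z\}$. Quantum overlapping tomography with parameter $1\le k\le n$ is the task for the family of all $S$ with $|S|\le k$; partial quantum overlapping tomography is the task for $M\ge 1$ prescribed sets $S_i$ with $|S_i|\le k$. 1. For constant $k$, the sample complexity of quantum overlapping tomography is $\Theta(\varepsilon^{-2}\log(n/\delta))$,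 both for joint and for Pauli schemes. Precisely: there is an absolute constant $c>0$ and, for each $k\ge 1$, a constant $C_k>0$ such that for all $n\ge k$, $0<\varepsilon\le 1/2$ and $0<\delta\le 1/2$ the sample complexities $m_{\mathrm{joint}}$ and $m_{\mathrm{Pauli}}$ exist and $$c\,\varepsilon^{-2}\log(n/\delta)\le m_{\mathrm{joint}}\le m_{\mathrm{Pauli}}\le C_k\,\varepsilon^{-2}\log(n/\delta).$$ 2. There is an absolute constant $C$ such that for all $1\le k\le n$, $\varepsilon>0$ and $0<\delta<1$ (with $\delta\le 1/2$ if $k=n$), quantum overlapping tomography can be accomplished by a Pauli scheme using at most $C\,\varepsilon^{-2}\,10^k\log\left(\binom nk/\delta\right)$ copies. 3. There is an absolute constant $C$ such that for all $1\le k\le n$, $M\ge1$, all $S_1,\dots,S_M$ with $|S_i|\le k$, $\varepsilon>0$ and $0<\delta<1$, partial quantum overlapping tomography can be accomplished by a Pauli scheme using at most $C\,\varepsilon^{-2}\,10^k\log(2M/\delta)$ copies. -/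

import Mathlib

open scoped ComplexOrder

noncomputable section

namespace OverlappingTomography

/-- Tensor product of a finite family of square matrices, acting on the product basis `ι → κ`. -/
def tensor {ι κ : Type*} [Fintype ι] (A : ι → Matrix κ κ ℂ) : Matrix (ι → κ) (ι → κ) ℂ :=
  Matrix.of fun x y => ∏ i, A i (x i) (y i)

/-- Operators on the qubits labelled by `ι`, in the computational basis `ι → Fin 2`. -/
abbrev Op (ι : Type*) := Matrix (ι → Fin 2) (ι → Fin 2) ℂ

/-- Density matrices: positive semidefinite of trace one. -/
def IsDensity {d : Type*} [Fintype d] (ρ : Matrix d d ℂ) : Prop :=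
  ρ.PosSemidef ∧ ρ.trace = 1

/-- The trace norm `‖A‖₁ = tr √(Aᴴ A)`, the sum of the singular values of `A`. -/
def traceNorm {d : Type*} [Fintype d] [DecidableEq d] (A : Matrix d d ℂ) : ℝ :=
  ∑ i, √((Matrix.isHermitian_conjTranspose_mul_self A).eigenvalues i)

/-- The basis label on all qubits that is `a` on `S` and `c` off `S`. -/
def glue {n : ℕ} (S : Finset (Fin n)) (a : {i // i ∈ S} → Fin 2) (c : {i // i ∉ S} → Fin 2) :
    Fin n → Fin 2 :=
  fun i => if h : i ∈ S then a ⟨i, h⟩ else c ⟨i, h⟩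

/-- The reduced matrix `ρ_S`: the partial trace of `ρ` over the qubits outside `S`. -/
def reduced {n : ℕ} (S : Finset (Fin n)) (ρ : Op (Fin n)) : Op {i // i ∈ S} :=
  Matrix.of fun a b => ∑ c : {i // i ∉ S} → Fin 2, ρ (glue S a c) (glue S b c)

/-- Operators on `m` copies of an `n`-qubit system. -/
abbrev CopiesOp (m n : ℕ) := Matrix (Fin m → Fin n → Fin 2) (Fin m → Fin n → Fin 2) ℂ

/-- The state `ρ ⊗ ⋯ ⊗ ρ` of `m` independent copies. -/
def copies {n : ℕ} (m : ℕ) (ρ : Op (Fin n)) : CopiesOp m n :=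
  tensor fun _ : Fin m => ρ

/-- A positive-operator valued measure with outcomes in `Ω`. -/
def IsPOVM {Ω d : Type*} [Fintype Ω] [Fintype d] [DecidableEq d] (E : Ω → Matrix d d ℂ) : Prop :=
  (∀ ω, (E ω).PosSemidef) ∧ ∑ ω, E ω = 1

open Classical in
/-- The estimator `est`, applied to the outcome `ω` of the measurement `E` of `m` copies of the
unknown state `ρ`, outputs density matrices which, for every `ρ`, are simultaneously for all `j`
within trace norm less than `ε` of `ρ_{S j}`, with probability at least `1 - δ`. -/
def Succeeds {n m : ℕ} {J Ω : Type*} [Fintype Ω] (S : J → Finset (Fin n)) (ε δ : ℝ)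
    (E : Ω → CopiesOp m n) (est : Ω → (j : J) → Op {i // i ∈ S j}) : Prop :=
  (∀ ω j, IsDensity (est ω j)) ∧
  ∀ ρ : Op (Fin n), IsDensity ρ →
    1 - δ ≤ ∑ ω with ∀ j, traceNorm (reduced (S j) ρ - est ω j) < ε,
      (E ω * copies m ρ).trace.re

/-- The reduced states on the sets `S j` can be learned from `m` copies by some joint measurement
of all the copies, followed by classical processing of the outcome. -/
def JointSolvable {n : ℕ} {J : Type*} (S : J → Finset (Fin n)) (ε δ : ℝ) (m : ℕ) : Prop :=
  ∃ (Ω : Type) (_ : Fintype Ω) (E : Ω → CopiesOp m n)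
    (est : Ω → (j : J) → Op {i // i ∈ S j}), IsPOVM E ∧ Succeeds S ε δ E est

/-- The Pauli matrices `σ_X`, `σ_Y`, `σ_Z`. -/
def pauli : Fin 3 → Matrix (Fin 2) (Fin 2) ℂ :=
  ![!![0, 1; 1, 0], !![0, -Complex.I; Complex.I, 0], !![1, 0; 0, -1]]

/-- The six-outcome single-qubit POVM `(1 ± σ_P) / 6`, `P ∈ {X, Y, Z}`: the outcome `(P, s)` says
that the uniformly random basis was `P` and that measuring in it gave `(-1) ^ s`. -/
def pauliEffect (o : Fin 3 × Fin 2) : Matrix (Fin 2) (Fin 2) ℂ :=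
  (1 / 6 : ℂ) • (1 + (-1 : ℂ) ^ (o.2 : ℕ) • pauli o.1)

/-- The measurement of every qubit of each of `m` copies in an independent, uniformly random
Pauli basis. -/
def randomPauli (m n : ℕ) (s : Fin m → Fin n → Fin 3 × Fin 2) : CopiesOp m n :=
  tensor fun j => tensor fun i => pauliEffect (s j i)

/-- The reduced states on the sets `S j` can be learned from `m` copies by measuring every qubit
of every copy in a random Pauli basis, followed by classical processing of the outcomes. -/
def PauliSolvable {n : ℕ} {J : Type*} (S : J → Finset (Fin n)) (ε δ : ℝ) (m : ℕ) : Prop :=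
  ∃ est : (Fin m → Fin n → Fin 3 × Fin 2) → (j : J) → Op {i // i ∈ S j},
    Succeeds S ε δ (randomPauli m n) est

/-- The family of all sets of at most `k` of the `n` qubits. -/
def localSets (n k : ℕ) : {S : Finset (Fin n) // S.card ≤ k} → Finset (Fin n) :=
  Subtype.val

end OverlappingTomography

end

noncomputable section

namespace OverlappingTomography

/-! Upper bounds. One randomly measured copy yields an unbiased estimate of `ρ_T`: the tensor
product over `T` of the matrices `9 F - 1`, where `F` is the observed effect. Its Frobenius norm is
exactly `√(5 ^ |T|)`. A dimension-free Hoeffding inequality in Hilbert space (`hilbert_hoeffding`)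
makes the empirical mean concentrate in Frobenius norm, and passing to the trace norm costs `√(2 ^
k)`; hence the factor `2 ^ k * 5 ^ k = 10 ^ k`. A union bound gives all sets at once, and any
density matrix compatible with the data serves as the output (`pauliSolvable_of_card_mul_exp_le`).
Smaller sets are controlled by their supersets of size `k`, so only `n.choose k` events are needed.

Lower bound. Single-qubit marginals already force it. On products of diagonal qubit states a joint
measurement is only a randomized test on coin tosses. Identifying one of `2 ^ n` bias patterns `±√2
ε` gives `log (n / δ) ≤ 4 ε² m + log 8` (`log_le_of_jointSolvable`). This is empty when `n / δ` is
bounded; there, three hypotheses are used, since at `δ = 1 / 2` two can be met by guessing. For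
small `ε` these are biases `0, ±√8 ε` and a chi-square estimate (`one_le_mul_of_jointSolvable`); for
larger `ε` it is enough that `m ≠ 0` (`pos_of_jointSolvable`). -/

open scoped MatrixOrder Matrix.Norms.L2Operator in
theorem exists_eq_conjTranspose_mul_self {d : Type*} [Fintype d] [DecidableEq d]
    {A : Matrix d d ℂ} (hA : A.PosSemidef) : ∃ B : Matrix d d ℂ, A = B.conjTranspose * B :=
  CStarAlgebra.nonneg_iff_eq_star_mul_self.mp hA.nonneg

/-! ### Algebra and positivity of tensor products. -/

section Tensor

variable {ι κ : Type*} [Fintype ι]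

theorem tensor_apply (A : ι → Matrix κ κ ℂ) (x y : ι → κ) :
    tensor A x y = ∏ i, A i (x i) (y i) := rfl

theorem tensor_mul [DecidableEq ι] [Fintype κ] (A B : ι → Matrix κ κ ℂ) :
    tensor A * tensor B = tensor fun i => A i * B i := by
  ext x y
  simp only [Matrix.mul_apply, tensor_apply, ← Finset.prod_mul_distrib]
  rw [Finset.prod_univ_sum, Fintype.piFinset_univ]

theorem trace_tensor [DecidableEq ι] [Fintype κ] (A : ι → Matrix κ κ ℂ) :
    (tensor A).trace = ∏ i, (A i).trace := by
  simp only [Matrix.trace, Matrix.diag_apply, tensor_apply]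
  rw [Finset.prod_univ_sum, Fintype.piFinset_univ]

theorem conjTranspose_tensor (A : ι → Matrix κ κ ℂ) :
    (tensor A).conjTranspose = tensor fun i => (A i).conjTranspose := by
  ext x y
  simp [Matrix.conjTranspose_apply, tensor_apply]

theorem tensor_one [DecidableEq κ] :
    tensor (fun _ : ι => (1 : Matrix κ κ ℂ)) = 1 := by
  ext x y
  simp only [tensor_apply, Matrix.one_apply, Finset.prod_ite_zero, Finset.prod_const_one,
    Finset.mem_univ, true_imp_iff, funext_iff]

theorem sum_tensor {Ω : Type*} [Fintype Ω] [DecidableEq ι] (A : ι → Ω → Matrix κ κ ℂ) :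
    ∑ s : ι → Ω, tensor (fun i => A i (s i)) = tensor fun i => ∑ o, A i o := by
  ext x y
  simp only [Matrix.sum_apply, tensor_apply]
  rw [Finset.prod_univ_sum, Fintype.piFinset_univ]

theorem posSemidef_tensor [DecidableEq ι] [Fintype κ] [DecidableEq κ] {A : ι → Matrix κ κ ℂ}
    (hA : ∀ i, (A i).PosSemidef) : (tensor A).PosSemidef := by
  choose B hB using fun i => exists_eq_conjTranspose_mul_self (hA i)
  have : tensor A = (tensor B).conjTranspose * tensor B := by
    rw [conjTranspose_tensor, tensor_mul]
    congr 1
    funext i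
    exact hB i
  rw [this]
  exact Matrix.posSemidef_conjTranspose_mul_self _

theorem isDensity_tensor [DecidableEq ι] [Fintype κ] [DecidableEq κ] {A : ι → Matrix κ κ ℂ}
    (hA : ∀ i, IsDensity (A i)) : IsDensity (tensor A) :=
  ⟨posSemidef_tensor fun i => (hA i).1, by
    rw [trace_tensor]; exact Finset.prod_eq_one fun i _ => (hA i).2⟩

end Tensor

/-- The trace of a product of two positive semidefinite matrices is nonnegative. -/
theorem trace_mul_nonneg {d : Type*} [Fintype d] [DecidableEq d] {A B : Matrix d d ℂ}
    (hA : A.PosSemidef) (hB : B.PosSemidef) : 0 ≤ (A * B).trace := by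
  obtain ⟨C, rfl⟩ := exists_eq_conjTranspose_mul_self hA
  rw [Matrix.mul_assoc, Matrix.trace_mul_comm]
  exact (hB.mul_mul_conjTranspose_same C).trace_nonneg

/-! ### Frobenius norm against trace norm. -/

section Frobenius

variable {d : Type*}

/-- A matrix as a vector of the Hilbert space whose norm is the Frobenius norm. -/
def frob (A : Matrix d d ℂ) : EuclideanSpace ℂ (d × d) :=
  WithLp.toLp 2 fun p => A p.1 p.2

theorem frob_add (A B : Matrix d d ℂ) : frob (A + B) = frob A + frob B := rfl

theorem frob_sub (A B : Matrix d d ℂ) : frob (A - B) = frob A - frob B := rfl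

variable [Fintype d]

theorem norm_frob_sq (A : Matrix d d ℂ) : ‖frob A‖ ^ 2 = ∑ i, ∑ j, ‖A i j‖ ^ 2 := by
  rw [EuclideanSpace.norm_sq_eq, Fintype.sum_prod_type]
  rfl

variable [DecidableEq d]

theorem sum_eigenvalues_eq_norm_frob_sq (A : Matrix d d ℂ) :
    ∑ i, (Matrix.isHermitian_conjTranspose_mul_self A).eigenvalues i = ‖frob A‖ ^ 2 := by
  have h := (Matrix.isHermitian_conjTranspose_mul_self A).trace_eq_sum_eigenvalues
  have h2 : (A.conjTranspose * A).trace = ((‖frob A‖ ^ 2 : ℝ) : ℂ) := by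
    rw [norm_frob_sq, Finset.sum_comm]
    simp only [Matrix.trace, Matrix.diag_apply, Matrix.mul_apply, Matrix.conjTranspose_apply]
    push_cast
    refine Finset.sum_congr rfl fun i _ => Finset.sum_congr rfl fun j _ => ?_
    simpa using Complex.conj_mul' (A j i)
  rw [h2] at h
  apply Complex.ofReal_injective
  rw [h, Complex.ofReal_sum]
  rfl

theorem eigenvalues_conjTranspose_mul_self_nonneg (A : Matrix d d ℂ) (i : d) :
    0 ≤ (Matrix.isHermitian_conjTranspose_mul_self A).eigenvalues i :=
  (Matrix.posSemidef_conjTranspose_mul_self A).eigenvalues_nonneg i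

/-- Cauchy–Schwarz on the singular values. -/
theorem traceNorm_le (A : Matrix d d ℂ) : traceNorm A ≤ √(Fintype.card d) * ‖frob A‖ := by
  rw [← Real.sqrt_sq (norm_nonneg (frob A)), ← Real.sqrt_mul (Nat.cast_nonneg _)]
  apply Real.le_sqrt_of_sq_le
  rw [← sum_eigenvalues_eq_norm_frob_sq, traceNorm]
  refine (sq_sum_le_card_mul_sum_sq (s := Finset.univ)).trans (le_of_eq ?_)
  rw [Finset.card_univ]
  congr 1
  exact Finset.sum_congr rfl fun i _ =>
    Real.sq_sqrt (eigenvalues_conjTranspose_mul_self_nonneg A i)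

theorem norm_frob_le_traceNorm (A : Matrix d d ℂ) : ‖frob A‖ ≤ traceNorm A := by
  have h0 : 0 ≤ traceNorm A := Finset.sum_nonneg fun i _ => Real.sqrt_nonneg _
  refine le_of_sq_le_sq ?_ h0
  rw [← sum_eigenvalues_eq_norm_frob_sq, traceNorm]
  refine le_trans (le_of_eq ?_) (Finset.sum_sq_le_sq_sum_of_nonneg fun i _ => Real.sqrt_nonneg _)
  exact Finset.sum_congr rfl fun i _ =>
    (Real.sq_sqrt (eigenvalues_conjTranspose_mul_self_nonneg A i)).symm

end Frobenius

/-! ### Partial traces. -/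

section Reduced

variable {n : ℕ} (S : Finset (Fin n))

theorem sum_glue {M : Type*} [AddCommMonoid M] (f : (Fin n → Fin 2) → M) :
    ∑ x, f x = ∑ a : {i // i ∈ S} → Fin 2, ∑ c : {i // i ∉ S} → Fin 2, f (glue S a c) := by
  rw [← Fintype.sum_prod_type']
  exact (Equiv.sum_comp (Equiv.piEquivPiSubtypeProd (· ∈ S) fun _ => Fin 2).symm f).symm

theorem glue_mem {a : {i // i ∈ S} → Fin 2} {c : {i // i ∉ S} → Fin 2} (i : {i // i ∈ S}) :
    glue S a c i = a i := by
  simp [glue]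

theorem glue_notMem {a : {i // i ∈ S} → Fin 2} {c : {i // i ∉ S} → Fin 2} (i : {i // i ∉ S}) :
    glue S a c i = c i := by
  simp [glue, i.2]

theorem reduced_sub (A B : Op (Fin n)) : reduced S (A - B) = reduced S A - reduced S B := by
  ext a b
  simp [reduced]

theorem trace_reduced (A : Op (Fin n)) : (reduced S A).trace = A.trace := by
  simp only [Matrix.trace, Matrix.diag_apply]
  rw [sum_glue S]
  rfl

theorem posSemidef_reduced {A : Op (Fin n)} (hA : A.PosSemidef) : (reduced S A).PosSemidef := by
  have : reduced S A = ∑ c, A.submatrix (fun a => glue S a c) (fun a => glue S a c) := by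
    ext a b
    simp [reduced, Matrix.sum_apply]
  rw [this]
  exact Matrix.posSemidef_sum _ fun c _ => hA.submatrix _

theorem IsDensity.reduced {A : Op (Fin n)} (hA : IsDensity A) : IsDensity (reduced S A) :=
  ⟨posSemidef_reduced S hA.1, (trace_reduced S A).trans hA.2⟩

theorem prod_mem_notMem {M : Type*} [CommMonoid M] (f : Fin n → M) :
    ∏ i, f i = (∏ i : {i // i ∈ S}, f i) * ∏ i : {i // i ∉ S}, f i := by
  convert (Fintype.prod_subtype_mul_prod_subtype (· ∈ S) f).symm

/-- The partial trace as a pairing with a product kernel. -/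
theorem reduced_apply_eq_sum (A : Op (Fin n)) (a b : {i // i ∈ S} → Fin 2) :
    reduced S A a b = ∑ x, ∑ y, A x y *
      ((∏ i : {i // i ∈ S}, if x i = a i ∧ y i = b i then 1 else 0) *
        ∏ i : {i // i ∉ S}, if x i = y i then 1 else 0) := by
  simp only [Finset.prod_ite_zero, Finset.prod_const_one, Finset.mem_univ, true_imp_iff]
  rw [sum_glue S]
  simp only [sum_glue S (fun y => A _ y * _), glue_mem, glue_notMem]
  have h1 : ∀ a' b' : {i // i ∈ S} → Fin 2,
      (∀ i, a' i = a i ∧ b' i = b i) ↔ a' = a ∧ b' = b := fun a' b' => by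
    rw [forall_and, funext_iff, funext_iff]
  have h2 : ∀ c c' : {i // i ∉ S} → Fin 2, (∀ i, c i = c' i) ↔ c = c' := fun c c' =>
    funext_iff.symm
  simp only [h1, h2, mul_ite, mul_one, mul_zero, ite_and]
  rw [Finset.sum_eq_single a]
  · simp only [if_true, reduced, Matrix.of_apply]
    refine Finset.sum_congr rfl fun c _ => ?_
    rw [Finset.sum_eq_single b]
    · simp
    · intro b' _ hb
      simp [hb]
    · simp
  · intro a' _ ha
    simp [ha]
  · simp

end Reduced

/-! ### Passing from a set of qubits to a subset. -/

section Monotone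

variable {n : ℕ} {S T : Finset (Fin n)}

/-- Labels on `T` split into labels on `S ⊆ T` and labels on `T \ S`. -/
def splitInner (h : S ⊆ T) :
    (({i // i ∈ S} → Fin 2) × ({i // i ∈ T ∧ i ∉ S} → Fin 2)) ≃ ({i // i ∈ T} → Fin 2) where
  toFun p i := if hi : i.1 ∈ S then p.1 ⟨i, hi⟩ else p.2 ⟨i, i.2, hi⟩
  invFun q := (fun i => q ⟨i, h i.2⟩, fun i => q ⟨i, i.2.1⟩)
  left_inv p := by
    ext i
    · simp
    · simp [i.2.2]
  right_inv q := by
    ext i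
    simp

/-- Labels off `S ⊆ T` split into labels on `T \ S` and labels off `T`. -/
def splitOuter (h : S ⊆ T) :
    (({i // i ∈ T ∧ i ∉ S} → Fin 2) × ({i // i ∉ T} → Fin 2)) ≃ ({i // i ∉ S} → Fin 2) where
  toFun p i := if hi : i.1 ∈ T then p.1 ⟨i, hi, i.2⟩ else p.2 ⟨i, hi⟩
  invFun q := (fun i => q ⟨i, i.2.2⟩, fun i => q ⟨i, fun hi => i.2 (h hi)⟩)
  left_inv p := by
    ext i
    · simp [i.2.1]
    · simp [i.2]
  right_inv q := by
    ext i
    simp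

theorem glue_split (h : S ⊆ T) (a : {i // i ∈ S} → Fin 2) (e : {i // i ∈ T ∧ i ∉ S} → Fin 2)
    (c : {i // i ∉ T} → Fin 2) :
    glue S a (splitOuter h (e, c)) = glue T (splitInner h (a, e)) c := by
  funext i
  by_cases hS : i ∈ S
  · simp [glue, splitInner, hS, h hS]
  · by_cases hT : i ∈ T <;> simp [glue, splitInner, splitOuter, hS, hT]

theorem reduced_apply_of_subset (h : S ⊆ T) (A : Op (Fin n)) (a b : {i // i ∈ S} → Fin 2) :
    reduced S A a b = ∑ e, reduced T A (splitInner h (a, e)) (splitInner h (b, e)) := by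
  simp only [reduced, Matrix.of_apply]
  rw [← Equiv.sum_comp (splitOuter h), Fintype.sum_prod_type]
  simp only [glue_split]

theorem card_split (h : S ⊆ T) :
    2 ^ S.card * Fintype.card ({i // i ∈ T ∧ i ∉ S} → Fin 2) = 2 ^ T.card := by
  have := Fintype.card_congr (splitInner h)
  simpa using this

/-- Cauchy–Schwarz over the labels on `T \ S` that are traced out. With the weight `2 ^ |S|` the
bound is exactly what transfers the trace-norm estimate from `T` to `S` without loss. -/
theorem norm_frob_reduced_le (h : S ⊆ T) (A : Op (Fin n)) :
    2 ^ S.card * ‖frob (reduced S A)‖ ^ 2 ≤ 2 ^ T.card * ‖frob (reduced T A)‖ ^ 2 := by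
  have hc : (2 : ℝ) ^ T.card =
      2 ^ S.card * Fintype.card ({i // i ∈ T ∧ i ∉ S} → Fin 2) := by
    exact_mod_cast (card_split h).symm
  rw [hc, mul_assoc]
  refine mul_le_mul_of_nonneg_left ?_ (by positivity)
  rw [norm_frob_sq, norm_frob_sq]
  have h1 : ∀ a b, ‖reduced S A a b‖ ^ 2 ≤ Fintype.card ({i // i ∈ T ∧ i ∉ S} → Fin 2) *
      ∑ e, ‖reduced T A (splitInner h (a, e)) (splitInner h (b, e))‖ ^ 2 := fun a b => by
    rw [reduced_apply_of_subset h]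
    refine le_trans (pow_le_pow_left₀ (norm_nonneg _) (norm_sum_le _ _) 2) ?_
    exact sq_sum_le_card_mul_sum_sq (s := Finset.univ)
  -- The left side keeps only the entries whose row and column agree on `T \ S`.
  have h2 : ∑ a, ∑ b, ∑ e, ‖reduced T A (splitInner h (a, e)) (splitInner h (b, e))‖ ^ 2 ≤
      ∑ i, ∑ j, ‖reduced T A i j‖ ^ 2 := by
    rw [← Equiv.sum_comp (splitInner h), Fintype.sum_prod_type]
    refine Finset.sum_le_sum fun a _ => ?_
    rw [Finset.sum_comm]
    refine Finset.sum_le_sum fun e _ => ?_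
    rw [← Equiv.sum_comp (splitInner h), Fintype.sum_prod_type]
    refine Finset.sum_le_sum fun b _ => ?_
    exact Finset.single_le_sum (f := fun e' =>
      ‖reduced T A (splitInner h (a, e)) (splitInner h (b, e'))‖ ^ 2)
      (fun _ _ => by positivity) (Finset.mem_univ e)
  refine le_trans ?_ (mul_le_mul_of_nonneg_left h2 (by positivity))
  simp only [Finset.mul_sum]
  refine Finset.sum_le_sum fun a _ => Finset.sum_le_sum fun b _ => ?_
  simpa only [Finset.mul_sum] using h1 a b

theorem traceNorm_reduced_le (h : S ⊆ T) (A : Op (Fin n)) :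
    traceNorm (reduced S A) ≤ √(2 ^ T.card) * ‖frob (reduced T A)‖ := by
  refine (traceNorm_le _).trans ?_
  have hn := norm_nonneg (frob (reduced T A))
  rw [← Real.sqrt_sq hn, ← Real.sqrt_sq (norm_nonneg (frob (reduced S A))),
    ← Real.sqrt_mul (by positivity), ← Real.sqrt_mul (by positivity)]
  refine Real.sqrt_le_sqrt ?_
  simpa using norm_frob_reduced_le h A

end Monotone

/-! ### Hoeffding's inequality in Hilbert space. -/

theorem hasSum_cosh_sqrt {s : ℝ} (hs : 0 ≤ s) :
    HasSum (fun n : ℕ => s ^ n / (2 * n).factorial) (Real.cosh √s) := by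
  have h := Real.hasSum_cosh √s
  simpa only [pow_mul, Real.sq_sqrt hs] using h

/-- The power series in `s` has nonnegative coefficients, and each power is convex on the half-line.
-/
theorem convexOn_cosh_sqrt : ConvexOn ℝ (Set.Ici 0) fun s => Real.cosh √s := by
  refine ⟨convex_Ici 0, fun x hx y hy a b ha hb hab => ?_⟩
  have hxy : 0 ≤ a • x + b • y := convex_Ici 0 hx hy ha hb hab
  have h1 := ((hasSum_cosh_sqrt hx).mul_left a).add ((hasSum_cosh_sqrt hy).mul_left b)
  refine hasSum_le (fun n => ?_) (hasSum_cosh_sqrt hxy) h1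
  have h2 := (convexOn_pow (𝕜 := ℝ) n).2 hx hy ha hb hab
  simp only [smul_eq_mul] at h2 ⊢
  rw [← mul_div_assoc, ← mul_div_assoc, ← add_div]
  exact div_le_div_of_nonneg_right h2 (by positivity)

/-- Chord bound for `cosh ∘ √` between `(a - c) ^ 2` and `(a + c) ^ 2`. -/
theorem cosh_sqrt_le {a c u : ℝ} (hu : |u| ≤ 1) :
    Real.cosh √(a ^ 2 + c ^ 2 + 2 * (a * c * u)) ≤
      Real.cosh a * Real.cosh c + u * (Real.sinh a * Real.sinh c) := by
  obtain ⟨h1, h2⟩ := abs_le.mp hu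
  have h := convexOn_cosh_sqrt.2 (Set.mem_Ici.mpr (sq_nonneg (a + c)))
    (Set.mem_Ici.mpr (sq_nonneg (a - c))) (show 0 ≤ (1 + u) / 2 by linarith)
    (show 0 ≤ (1 - u) / 2 by linarith) (by ring)
  simp only [smul_eq_mul, Real.sqrt_sq_eq_abs, Real.cosh_abs, Real.cosh_add, Real.cosh_sub] at h
  have e : (1 + u) / 2 * (a + c) ^ 2 + (1 - u) / 2 * (a - c) ^ 2 =
    a ^ 2 + c ^ 2 + 2 * (a * c * u) := by ring
  rw [e] at h
  linarith

section Hilbert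

variable {E : Type*} [NormedAddCommGroup E] [InnerProductSpace ℂ E]

/-- The chord bound applies with `‖v‖` enlarged to `c`. The result is affine in `inner ℂ x v`, so
the second term vanishes on average when `v` is centred. -/
theorem cosh_norm_add_le {c : ℝ} (hc : 0 < c) (x v : E) (hv : ‖v‖ ≤ c) :
    Real.cosh ‖x + v‖ ≤ Real.cosh ‖x‖ * Real.cosh c +
      (inner ℂ x v).re * (Real.sinh ‖x‖ * Real.sinh c / (‖x‖ * c)) := by
  have hin : |(inner ℂ x v).re| ≤ ‖x‖ * c :=
    (Complex.abs_re_le_norm _).trans ((norm_inner_le_norm x v).trans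
      (mul_le_mul_of_nonneg_left hv (norm_nonneg x)))
  rcases eq_or_ne x 0 with rfl | hx
  · simp only [zero_add, norm_zero, Real.cosh_zero, one_mul, inner_zero_left, Complex.zero_re,
      zero_mul, add_zero]
    exact Real.cosh_le_cosh.mpr (by rwa [abs_of_nonneg (norm_nonneg v), abs_of_pos hc])
  · have hxc : 0 < ‖x‖ * c := mul_pos (norm_pos_iff.mpr hx) hc
    have h := cosh_sqrt_le (a := ‖x‖) (c := c) (u := (inner ℂ x v).re / (‖x‖ * c))
      (by rw [abs_div, abs_of_pos hxc]; exact (div_le_one hxc).mpr hin)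
    have e : ‖x‖ * c * ((inner ℂ x v).re / (‖x‖ * c)) = (inner ℂ x v).re := by
      field_simp
    rw [e] at h
    refine le_trans ?_ (h.trans (le_of_eq (by ring)))
    rw [Real.cosh_le_cosh, abs_of_nonneg (norm_nonneg _), abs_of_nonneg (Real.sqrt_nonneg _)]
    refine Real.le_sqrt_of_sq_le ?_
    have h2 : ‖x + v‖ ^ 2 = ‖x‖ ^ 2 + 2 * (inner ℂ x v).re + ‖v‖ ^ 2 := norm_add_sq (𝕜 := ℂ) x v
    rw [h2]
    nlinarith [norm_nonneg v]

variable {O : Type*} [Fintype O]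

theorem sum_cosh_norm_add_le {p : O → ℝ} (hp : ∀ o, 0 ≤ p o) (hp1 : ∑ o, p o = 1) {v : O → E}
    (hv0 : ∑ o, (p o : ℂ) • v o = 0) {c : ℝ} (hc : 0 < c) (hv : ∀ o, ‖v o‖ ≤ c) (x : E) :
    ∑ o, p o * Real.cosh ‖x + v o‖ ≤ Real.cosh ‖x‖ * Real.cosh c := by
  have h0 : ∑ o, p o * (inner ℂ x (v o)).re = 0 := by
    have := congrArg (fun w => (inner ℂ x w).re) hv0
    simpa [inner_sum, inner_smul_right] using this
  calc ∑ o, p o * Real.cosh ‖x + v o‖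
      ≤ ∑ o, p o * (Real.cosh ‖x‖ * Real.cosh c +
          (inner ℂ x (v o)).re * (Real.sinh ‖x‖ * Real.sinh c / (‖x‖ * c))) :=
        Finset.sum_le_sum fun o _ =>
          mul_le_mul_of_nonneg_left (cosh_norm_add_le hc x (v o) (hv o)) (hp o)
    _ = (∑ o, p o) * (Real.cosh ‖x‖ * Real.cosh c) + (∑ o, p o * (inner ℂ x (v o)).re) *
          (Real.sinh ‖x‖ * Real.sinh c / (‖x‖ * c)) := by
        rw [Finset.sum_mul, Finset.sum_mul, ← Finset.sum_add_distrib]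
        exact Finset.sum_congr rfl fun o _ => by ring
    _ = Real.cosh ‖x‖ * Real.cosh c := by rw [hp1, h0]; ring

theorem sum_prod_cosh_norm_add_le {p : O → ℝ} (hp : ∀ o, 0 ≤ p o) (hp1 : ∑ o, p o = 1)
    {v : O → E} (hv0 : ∑ o, (p o : ℂ) • v o = 0) {c : ℝ} (hc : 0 < c) (hv : ∀ o, ‖v o‖ ≤ c)
    (m : ℕ) (x : E) :
    ∑ s : Fin m → O, (∏ j, p (s j)) * Real.cosh ‖x + ∑ j, v (s j)‖ ≤
      Real.cosh ‖x‖ * Real.cosh c ^ m := by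
  induction m generalizing x with
  | zero => simp
  | succ m ih =>
    rw [← Equiv.sum_comp (Fin.consEquiv fun _ => O), Fintype.sum_prod_type]
    simp only [Fin.consEquiv_apply, Fin.prod_univ_succ, Fin.sum_univ_succ, Fin.cons_zero,
      Fin.cons_succ]
    calc _ = ∑ o, p o * ∑ s : Fin m → O, (∏ j, p (s j)) *
              Real.cosh ‖(x + v o) + ∑ j, v (s j)‖ := by
          refine Finset.sum_congr rfl fun o _ => ?_
          rw [Finset.mul_sum]
          exact Finset.sum_congr rfl fun s _ => by rw [add_assoc, mul_assoc]
      _ ≤ ∑ o, p o * (Real.cosh ‖x + v o‖ * Real.cosh c ^ m) :=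
          Finset.sum_le_sum fun o _ => mul_le_mul_of_nonneg_left (ih _) (hp o)
      _ = (∑ o, p o * Real.cosh ‖x + v o‖) * Real.cosh c ^ m := by
          rw [Finset.sum_mul]
          exact Finset.sum_congr rfl fun o _ => by ring
      _ ≤ (Real.cosh ‖x‖ * Real.cosh c) * Real.cosh c ^ m :=
          mul_le_mul_of_nonneg_right (sum_cosh_norm_add_le hp hp1 hv0 hc hv x)
            (pow_nonneg (Real.cosh_pos c).le m)
      _ = Real.cosh ‖x‖ * Real.cosh c ^ (m + 1) := by ring

/-- Hoeffding's inequality for a sum of `m` independent centred bounded vectors of a Hilbert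
space. -/
theorem hilbert_hoeffding {p : O → ℝ} (hp : ∀ o, 0 ≤ p o) (hp1 : ∑ o, p o = 1)
    {v : O → E} (hv0 : ∑ o, (p o : ℂ) • v o = 0) {c : ℝ} (hc : 0 < c) (hv : ∀ o, ‖v o‖ ≤ c)
    (m : ℕ) {t : ℝ} (ht : 0 < t) (B : Finset (Fin m → O))
    (hB : ∀ s ∈ B, m * t ≤ ‖∑ j, v (s j)‖) :
    ∑ s ∈ B, ∏ j, p (s j) ≤ 2 * Real.exp (-(m * t ^ 2 / (2 * c ^ 2))) := by
  -- This `l` minimises the Chernoff exponent `m * (l ^ 2 * c ^ 2 / 2 - l * t)`.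
  set l : ℝ := t / c ^ 2 with hl
  have hl0 : 0 < l := by positivity
  have hw : ∀ s : Fin m → O, 0 ≤ ∏ j, p (s j) := fun s => Finset.prod_nonneg fun j _ => hp _
  have h1 := sum_prod_cosh_norm_add_le hp hp1 (v := fun o => (l : ℂ) • v o)
    (by
      have : ∑ o, (p o : ℂ) • (l : ℂ) • v o = (l : ℂ) • ∑ o, (p o : ℂ) • v o := by
        rw [Finset.smul_sum]
        exact Finset.sum_congr rfl fun o _ => smul_comm _ _ _
      rw [this, hv0, smul_zero])
    (c := l * c) (by positivity)
    (fun o => by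
      rw [norm_smul, Complex.norm_real, Real.norm_of_nonneg hl0.le]
      exact mul_le_mul_of_nonneg_left (hv o) hl0.le) m 0
  simp only [zero_add, norm_zero, Real.cosh_zero, one_mul, ← Finset.smul_sum, norm_smul,
    Complex.norm_real, Real.norm_of_nonneg hl0.le] at h1
  -- Markov's inequality for `cosh`, using `exp r / 2 ≤ cosh r`; this is the source of the prefactor
  -- `2`.
  have h2 : (∑ s ∈ B, ∏ j, p (s j)) * (Real.exp (l * (m * t)) / 2) ≤
      Real.exp ((l * c) ^ 2 / 2) ^ m := by
    refine le_trans ?_ (h1.trans (pow_le_pow_left₀ (Real.cosh_pos _).le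
      (Real.cosh_le_exp_half_sq _) m))
    rw [Finset.sum_mul]
    refine le_trans (Finset.sum_le_sum fun s hs => mul_le_mul_of_nonneg_left ?_ (hw s))
      (Finset.sum_le_univ_sum_of_nonneg fun s => mul_nonneg (hw s) (Real.cosh_pos _).le)
    have h3 : Real.exp (l * (m * t)) ≤ Real.exp (l * ‖∑ j, v (s j)‖) :=
      Real.exp_le_exp.mpr (mul_le_mul_of_nonneg_left (hB s hs) hl0.le)
    rw [Real.cosh_eq]
    have := Real.exp_pos (-(l * ‖∑ j, v (s j)‖))
    linarith
  rw [← Real.exp_nat_mul] at h2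
  have h4 : (∑ s ∈ B, ∏ j, p (s j)) =
      (∑ s ∈ B, ∏ j, p (s j)) * (Real.exp (l * (m * t)) / 2) *
        (2 * Real.exp (-(l * (m * t)))) := by
    rw [Real.exp_neg]
    field_simp
  rw [h4]
  refine (mul_le_mul_of_nonneg_right h2 (by positivity)).trans (le_of_eq ?_)
  rw [mul_left_comm, ← Real.exp_add]
  congr 2
  rw [hl]
  field_simp
  ring

end Hilbert

/-! ### The six-outcome qubit POVM and its inversion. -/

section Effects

/-- Each effect is one third of a projection; this form gives positivity. -/
theorem pauliEffect_eq (o : Fin 3 × Fin 2) :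
    pauliEffect o = (3 : ℂ) • ((pauliEffect o).conjTranspose * pauliEffect o) := by
  obtain ⟨P, s⟩ := o
  ext x y
  fin_cases P <;> fin_cases s <;> fin_cases x <;> fin_cases y <;>
    simp [pauliEffect, pauli, Matrix.mul_apply, Fin.sum_univ_two, Matrix.conjTranspose_apply,
      map_ofNat] <;>
    ring_nf <;> simp <;> norm_num

theorem posSemidef_pauliEffect (o : Fin 3 × Fin 2) : (pauliEffect o).PosSemidef := by
  rw [pauliEffect_eq]
  exact (Matrix.posSemidef_conjTranspose_mul_self _).smul (by norm_num)

theorem sum_pauliEffect : ∑ o, pauliEffect o = 1 := by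
  ext x y
  rw [Fintype.sum_prod_type]
  fin_cases x <;> fin_cases y <;>
    simp [pauliEffect, pauli, Fin.sum_univ_three, Matrix.add_apply] <;> norm_num

/-- The inversion `9 F - 1` of the measurement channel on the outcome with effect `F`. -/
def shadowFactor (o : Fin 3 × Fin 2) : Matrix (Fin 2) (Fin 2) ℂ :=
  (9 : ℂ) • pauliEffect o - 1

/-- This is `∑ tr(F ρ) (9 F - 1) = ρ` read off on matrix units: the sum of `F ⊗ (9 F - 1)` is the
swap. -/
theorem sum_pauliEffect_mul_shadowFactor (x y a b : Fin 2) :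
    ∑ o, pauliEffect o x y * shadowFactor o a b = if y = a ∧ x = b then 1 else 0 := by
  rw [Fintype.sum_prod_type]
  fin_cases x <;> fin_cases y <;> fin_cases a <;> fin_cases b <;>
    simp [pauliEffect, pauli, shadowFactor, Fin.sum_univ_three, Matrix.add_apply] <;>
    ring_nf <;> simp <;> norm_num

/-- `9 F - 1` has eigenvalues `2` and `-1`. -/
theorem norm_frob_shadowFactor_sq (o : Fin 3 × Fin 2) : ‖frob (shadowFactor o)‖ ^ 2 = 5 := by
  rw [norm_frob_sq]
  obtain ⟨P, s⟩ := o
  fin_cases P <;> fin_cases s <;>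
    simp [shadowFactor, pauliEffect, pauli, Fin.sum_univ_two, ← Complex.normSq_eq_norm_sq,
      Complex.normSq_apply] <;>
    norm_num

theorem norm_frob_tensor_sq {ι κ : Type*} [Fintype ι] [DecidableEq ι] [Fintype κ]
    (A : ι → Matrix κ κ ℂ) : ‖frob (tensor A)‖ ^ 2 = ∏ i, ‖frob (A i)‖ ^ 2 := by
  simp only [norm_frob_sq, tensor_apply, norm_prod, ← Finset.prod_pow]
  rw [Finset.prod_univ_sum, Fintype.piFinset_univ]
  refine Finset.sum_congr rfl fun x _ => ?_
  rw [Finset.prod_univ_sum, Fintype.piFinset_univ]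

end Effects

theorem isPOVM_randomPauli (m n : ℕ) : IsPOVM (randomPauli m n) := by
  refine ⟨fun s => posSemidef_tensor fun j => posSemidef_tensor fun i =>
    posSemidef_pauliEffect _, ?_⟩
  refine (sum_tensor fun (_ : Fin m) (o : Fin n → Fin 3 × Fin 2) =>
    tensor fun i => pauliEffect (o i)).trans ?_
  simp only [sum_tensor fun (_ : Fin n) o => pauliEffect o, sum_pauliEffect, tensor_one]

theorem PauliSolvable.jointSolvable {n : ℕ} {J : Type*} {S : J → Finset (Fin n)} {ε δ : ℝ} {m : ℕ}
    (h : PauliSolvable S ε δ m) : JointSolvable S ε δ m := by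
  obtain ⟨est, h⟩ := h
  exact ⟨_, inferInstance, randomPauli m n, est, isPOVM_randomPauli m n, h⟩

/-! ### Unbiased estimates from one copy, and their concentration. -/

section Shadow

variable {n : ℕ}

/-- The probability of an outcome when one copy of `ρ` is measured in random Pauli bases. -/
def outcomeProb (ρ : Op (Fin n)) (o : Fin n → Fin 3 × Fin 2) : ℝ :=
  (tensor (fun i => pauliEffect (o i)) * ρ).trace.re

/-- The single-copy unbiased estimate of the reduced state on `T`. -/
def shadow (T : Finset (Fin n)) (o : Fin n → Fin 3 × Fin 2) : Op {i // i ∈ T} :=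
  tensor fun i : {i // i ∈ T} => shadowFactor (o i)

variable {ρ : Op (Fin n)}

theorem trace_effect_nonneg (hρ : IsDensity ρ) (o : Fin n → Fin 3 × Fin 2) :
    0 ≤ (tensor (fun i => pauliEffect (o i)) * ρ).trace :=
  trace_mul_nonneg (posSemidef_tensor fun _ => posSemidef_pauliEffect _) hρ.1

theorem outcomeProb_nonneg (hρ : IsDensity ρ) (o : Fin n → Fin 3 × Fin 2) :
    0 ≤ outcomeProb ρ o :=
  (Complex.nonneg_iff.mp (trace_effect_nonneg hρ o)).1

theorem ofReal_outcomeProb (hρ : IsDensity ρ) (o : Fin n → Fin 3 × Fin 2) :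
    (outcomeProb ρ o : ℂ) = (tensor (fun i => pauliEffect (o i)) * ρ).trace :=
  Complex.ext rfl (Complex.nonneg_iff.mp (trace_effect_nonneg hρ o)).2

theorem sum_outcomeProb (hρ : IsDensity ρ) : ∑ o, outcomeProb ρ o = 1 := by
  apply Complex.ofReal_injective
  rw [Complex.ofReal_sum]
  simp only [ofReal_outcomeProb hρ]
  rw [← Matrix.trace_sum, ← Finset.sum_mul, sum_tensor fun (_ : Fin n) o => pauliEffect o]
  simp only [sum_pauliEffect, tensor_one, one_mul, hρ.2, Complex.ofReal_one]

theorem trace_randomPauli_mul_copies (hρ : IsDensity ρ) {m : ℕ}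
    (s : Fin m → Fin n → Fin 3 × Fin 2) :
    (randomPauli m n s * copies m ρ).trace.re = ∏ j, outcomeProb ρ (s j) := by
  rw [randomPauli, copies, tensor_mul, trace_tensor]
  simp only [← ofReal_outcomeProb hρ, ← Complex.ofReal_prod, Complex.ofReal_re]

theorem norm_frob_shadow (T : Finset (Fin n)) (o : Fin n → Fin 3 × Fin 2) :
    ‖frob (shadow T o)‖ = √(5 ^ T.card) := by
  rw [← Real.sqrt_sq (norm_nonneg _), shadow, norm_frob_tensor_sq]
  simp [norm_frob_shadowFactor_sq]

/-- The sum over outcomes factorises over qubits. On `T` the inversion formula returns the matrix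
entry; off `T` the effects sum to the identity, which is the partial trace. -/
theorem sum_outcomeProb_smul_shadow (hρ : IsDensity ρ) (T : Finset (Fin n)) :
    ∑ o, (outcomeProb ρ o : ℂ) • shadow T o = reduced T ρ := by
  ext a b
  rw [reduced_apply_eq_sum, Matrix.sum_apply, Finset.sum_comm]
  simp only [Matrix.smul_apply, smul_eq_mul, ofReal_outcomeProb hρ, Matrix.trace, Matrix.diag_apply,
    Matrix.mul_apply, Finset.sum_mul]
  rw [Finset.sum_comm]
  refine Finset.sum_congr rfl fun x _ => ?_
  rw [Finset.sum_comm]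
  refine Finset.sum_congr rfl fun y _ => ?_
  let K : Fin n → Fin 3 × Fin 2 → ℂ := fun i o => pauliEffect o (x i) (y i) *
    if h : i ∈ T then shadowFactor o (a ⟨i, h⟩) (b ⟨i, h⟩) else 1
  have hK : ∀ o : Fin n → Fin 3 × Fin 2,
      tensor (fun i => pauliEffect (o i)) x y * ρ y x * shadow T o a b =
        ρ y x * ∏ i, K i (o i) := fun o => by
    have : shadow T o a b =
        ∏ i, if h : i ∈ T then shadowFactor (o i) (a ⟨i, h⟩) (b ⟨i, h⟩) else 1 := by
      rw [prod_mem_notMem T]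
      have h1 : ∀ i : {i // i ∉ T}, (if h : (i : Fin n) ∈ T then
          shadowFactor (o i) (a ⟨i, h⟩) (b ⟨i, h⟩) else 1) = 1 := fun i => dif_neg i.2
      simp only [h1, Finset.prod_const_one, mul_one]
      exact Finset.prod_congr rfl fun i _ => by simp
    rw [this, Finset.prod_mul_distrib, tensor_apply]
    ring
  simp only [hK]
  rw [← Finset.mul_sum, ← Fintype.piFinset_univ, ← Finset.prod_univ_sum, prod_mem_notMem T]
  congr 2
  · refine Finset.prod_congr rfl fun i _ => ?_
    rw [← sum_pauliEffect_mul_shadowFactor]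
    exact Finset.sum_congr rfl fun o _ => by simp [K]
  · refine Finset.prod_congr rfl fun i _ => ?_
    have := congrFun (congrFun sum_pauliEffect (x i)) (y i)
    rw [Matrix.sum_apply, Matrix.one_apply] at this
    rw [if_congr (eq_comm (a := y i)) rfl rfl, ← this]
    exact Finset.sum_congr rfl fun o _ => by simp [K, i.2]

theorem frob_sum {d Ω : Type*} [Fintype Ω] (A : Ω → Matrix d d ℂ) :
    frob (∑ o, A o) = ∑ o, frob (A o) :=
  map_sum (AddMonoidHom.mk' frob frob_add) A Finset.univ

theorem sum_outcomeProb_smul_frob_shadow (hρ : IsDensity ρ) (T : Finset (Fin n)) :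
    ∑ o, (outcomeProb ρ o : ℂ) • frob (shadow T o) = frob (reduced T ρ) := by
  rw [← sum_outcomeProb_smul_shadow hρ, frob_sum]
  rfl

/-- `ρ_T` is a mean of shadows of this norm. The bound is crude, but it suffices for the centred
shadows to have norm at most `2 * √(5 ^ |T|)`. -/
theorem norm_frob_reduced_le_sqrt (hρ : IsDensity ρ) (T : Finset (Fin n)) :
    ‖frob (reduced T ρ)‖ ≤ √(5 ^ T.card) := by
  rw [← sum_outcomeProb_smul_frob_shadow hρ]
  refine (norm_sum_le _ _).trans (le_of_eq ?_)
  simp only [norm_smul, norm_frob_shadow, Complex.norm_real,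
    Real.norm_of_nonneg (outcomeProb_nonneg hρ _)]
  rw [← Finset.sum_mul, sum_outcomeProb hρ, one_mul]

/-- The empirical mean of the shadows on `T` deviates from `ρ_T` by `t` with exponentially small
probability. -/
theorem shadow_tail (hρ : IsDensity ρ) (T : Finset (Fin n)) (m : ℕ) {t : ℝ} (ht : 0 < t)
    (B : Finset (Fin m → Fin n → Fin 3 × Fin 2))
    (hB : ∀ s ∈ B, m * t ≤ ‖∑ j, (frob (shadow T (s j)) - frob (reduced T ρ))‖) :
    ∑ s ∈ B, ∏ j, outcomeProb ρ (s j) ≤ 2 * Real.exp (-(m * t ^ 2 / (8 * 5 ^ T.card))) := by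
  have h := hilbert_hoeffding (outcomeProb_nonneg hρ) (sum_outcomeProb hρ)
    (v := fun o => frob (shadow T o) - frob (reduced T ρ)) (c := 2 * √(5 ^ T.card))
    (by
      simp only [smul_sub, Finset.sum_sub_distrib]
      rw [sum_outcomeProb_smul_frob_shadow hρ, ← Finset.sum_smul, ← Complex.ofReal_sum,
        sum_outcomeProb hρ, Complex.ofReal_one, one_smul, sub_self])
    (by positivity)
    (fun o => (norm_sub_le _ _).trans (by
      rw [norm_frob_shadow]
      linarith [norm_frob_reduced_le_sqrt hρ T])) m ht B hB
  rw [mul_pow, Real.sq_sqrt (by positivity)] at h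
  convert h using 5
  ring

end Shadow

theorem sum_biUnion_le {α β : Type*} [DecidableEq α] [DecidableEq β] (s : Finset α)
    (t : α → Finset β) {f : β → ℝ} (hf : ∀ x, 0 ≤ f x) :
    ∑ x ∈ s.biUnion t, f x ≤ ∑ a ∈ s, ∑ x ∈ t a, f x := by
  induction s using Finset.induction_on with
  | empty => simp
  | insert a s ha ih =>
    rw [Finset.biUnion_insert, Finset.sum_insert ha]
    have h1 := Finset.sum_union_inter (s₁ := t a) (s₂ := s.biUnion t) (f := f)
    have h2 := Finset.sum_nonneg (s := t a ∩ s.biUnion t) fun x _ => hf x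
    linarith

/-! ### The Pauli scheme and its number of copies. -/

section Scheme

variable {n : ℕ} {L J : Type*} {S : J → Finset (Fin n)} {T : L → Finset (Fin n)}
  {k : ℕ} {ε δ : ℝ}

theorem exists_isDensity (n : ℕ) : ∃ τ : Op (Fin n), IsDensity τ :=
  ⟨tensor fun _ => Matrix.diagonal ![1, 0], isDensity_tensor fun _ => ⟨by
    refine Matrix.PosSemidef.diagonal fun i => ?_
    fin_cases i <;> simp, by simp [Matrix.trace, Fin.sum_univ_two]⟩⟩

/-- The measured shadows are compatible with `τ` on all sets `T l`, up to `t`. -/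
def Compatible {m : ℕ} (T : L → Finset (Fin n)) (t : ℝ) (s : Fin m → Fin n → Fin 3 × Fin 2)
    (τ : Op (Fin n)) : Prop :=
  ∀ l, ‖∑ j, (frob (shadow (T l) (s j)) - frob (reduced (T l) τ))‖ < m * t

/-- Both states are within `t` of the same empirical mean, hence within `2 * t` of each other in
Frobenius norm; `t` is chosen so that `√(2 ^ k) * (2 * t) = ε`. -/
theorem traceNorm_lt_of_compatible {m : ℕ} (hT : ∀ l, (T l).card ≤ k) {l : L} {R : Finset (Fin n)}
    (hR : R ⊆ T l) {s : Fin m → Fin n → Fin 3 × Fin 2} {ρ τ : Op (Fin n)}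
    (hρ : Compatible T (ε / (2 * √(2 ^ k))) s ρ) (hτ : Compatible T (ε / (2 * √(2 ^ k))) s τ) :
    traceNorm (reduced R (ρ - τ)) < ε := by
  have h1 := hρ l
  have h2 := hτ l
  set t := ε / (2 * √(2 ^ k)) with ht
  have hk : 0 < √((2 : ℝ) ^ k) := by positivity
  -- With no copies the strict inequality in `Compatible` would read `0 < 0`.
  have hm : 0 < (m : ℝ) := by
    rcases Nat.eq_zero_or_pos m with rfl | h
    · simp at h1
    · exact_mod_cast h
  have h3 : ∑ j, (frob (shadow (T l) (s j)) - frob (reduced (T l) τ)) -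
      ∑ j, (frob (shadow (T l) (s j)) - frob (reduced (T l) ρ)) =
      (m : ℂ) • frob (reduced (T l) (ρ - τ)) := by
    rw [← Finset.sum_sub_distrib, reduced_sub, frob_sub]
    simp [← smul_sub, ← Nat.cast_smul_eq_nsmul ℂ]
  have h4 : m * ‖frob (reduced (T l) (ρ - τ))‖ < m * (2 * t) := by
    have : ‖(m : ℂ) • frob (reduced (T l) (ρ - τ))‖ = m * ‖frob (reduced (T l) (ρ - τ))‖ := by
      rw [norm_smul]; simp
    rw [← this, ← h3]
    refine (norm_sub_le _ _).trans_lt ?_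
    linarith
  have h5 := lt_of_mul_lt_mul_left h4 hm.le
  calc traceNorm (reduced R (ρ - τ)) ≤ √(2 ^ (T l).card) * ‖frob (reduced (T l) (ρ - τ))‖ :=
        traceNorm_reduced_le hR _
    _ ≤ √(2 ^ k) * ‖frob (reduced (T l) (ρ - τ))‖ := by
        refine mul_le_mul_of_nonneg_right (Real.sqrt_le_sqrt ?_) (norm_nonneg _)
        exact pow_le_pow_right₀ one_le_two (hT l)
    _ < √(2 ^ k) * (2 * t) := mul_lt_mul_of_pos_left h5 hk
    _ = ε := by rw [ht]; field_simp

variable [Fintype L]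

open Classical in
/-- The sets `S j`, each inside one of the sets `T l` of at most `k` qubits, can be learned from
`m` randomly measured copies as soon as `2 |L| exp (- m ε² / (32 · 10 ^ k)) ≤ δ`. -/
theorem pauliSolvable_of_card_mul_exp_le (hT : ∀ l, (T l).card ≤ k) (hS : ∀ j, ∃ l, S j ⊆ T l)
    (hε : 0 < ε) {m : ℕ}
    (hm : Fintype.card L * (2 * Real.exp (-(m * ε ^ 2 / (32 * 10 ^ k)))) ≤ δ) :
    PauliSolvable S ε δ m := by
  set t := ε / (2 * √(2 ^ k)) with ht
  have ht0 : 0 < t := by positivity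
  obtain ⟨τ₀, hτ₀⟩ := exists_isDensity n
  -- The empirical mean need not be positive, so the output is reduced from some state compatible
  -- with the data. On the good event the true state witnesses that one exists; otherwise `τ₀` is a
  -- dummy.
  have hex : ∀ s : Fin m → Fin n → Fin 3 × Fin 2, ∃ τ, IsDensity τ ∧
      ((∃ ρ, IsDensity ρ ∧ Compatible T t s ρ) → Compatible T t s τ) := fun s => by
    by_cases h : ∃ ρ, IsDensity ρ ∧ Compatible T t s ρ
    · obtain ⟨ρ, h1, h2⟩ := h
      exact ⟨ρ, h1, fun _ => h2⟩
    · exact ⟨τ₀, hτ₀, fun h' => absurd h' h⟩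
  choose τ hτ hτc using hex
  refine ⟨fun s j => reduced (S j) (τ s), fun s j => (hτ s).reduced _, fun ρ hρ => ?_⟩
  simp only [trace_randomPauli_mul_copies hρ]
  have hw : ∀ s : Fin m → Fin n → Fin 3 × Fin 2, 0 ≤ ∏ j, outcomeProb ρ (s j) :=
    fun s => Finset.prod_nonneg fun j _ => outcomeProb_nonneg hρ _
  have htot : ∑ s : Fin m → Fin n → Fin 3 × Fin 2, ∏ j, outcomeProb ρ (s j) = 1 := by
    rw [← Fintype.piFinset_univ, ← Finset.prod_univ_sum (fun _ => Finset.univ)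
      (fun (_ : Fin m) o => outcomeProb ρ o)]
    simp [sum_outcomeProb hρ]
  have hgood : ∀ s, Compatible T t s ρ →
      ∀ j, traceNorm (reduced (S j) ρ - reduced (S j) (τ s)) < ε := fun s hs j => by
    obtain ⟨l, hl⟩ := hS j
    rw [← reduced_sub]
    exact traceNorm_lt_of_compatible hT hl hs (hτc s ⟨ρ, hρ, hs⟩)
  have hbad : ∑ s : Fin m → Fin n → Fin 3 × Fin 2 with ¬ Compatible T t s ρ,
      ∏ j, outcomeProb ρ (s j) ≤ δ := by
    refine le_trans ?_ hm
    let B : L → Finset (Fin m → Fin n → Fin 3 × Fin 2) := fun l =>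
      Finset.univ.filter fun s =>
        m * t ≤ ‖∑ j, (frob (shadow (T l) (s j)) - frob (reduced (T l) ρ))‖
    have hsub : (Finset.univ.filter fun s => ¬ Compatible T t s ρ) ⊆ Finset.univ.biUnion B := by
      intro s hs
      simpa [Compatible, B] using hs
    refine (Finset.sum_le_sum_of_subset_of_nonneg hsub fun s _ _ => hw s).trans ?_
    refine (sum_biUnion_le _ _ hw).trans ?_
    rw [← Finset.card_univ, ← nsmul_eq_mul]
    refine Finset.sum_le_card_nsmul _ _ _ fun l _ => ?_
    refine (shadow_tail hρ (T l) m ht0 (B l) fun s hs => (Finset.mem_filter.mp hs).2).trans ?_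
    refine mul_le_mul_of_nonneg_left (Real.exp_le_exp.mpr (neg_le_neg ?_)) zero_le_two
    have e : (m : ℝ) * ε ^ 2 / (32 * 10 ^ k) = m * t ^ 2 / (8 * 5 ^ k) := by
      rw [ht, div_pow, mul_pow, Real.sq_sqrt (by positivity),
        show (10 : ℝ) ^ k = 2 ^ k * 5 ^ k by rw [← mul_pow]; norm_num]
      field_simp
      ring
    rw [e]
    refine div_le_div_of_nonneg_left (by positivity) (by positivity) ?_
    exact mul_le_mul_of_nonneg_left (pow_le_pow_right₀ (by norm_num) (hT l)) (by norm_num)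
  have hsplit := Finset.sum_filter_add_sum_filter_not Finset.univ
    (fun s : Fin m → Fin n → Fin 3 × Fin 2 => Compatible T t s ρ)
    (fun s => ∏ j, outcomeProb ρ (s j))
  have hle : ∑ s : Fin m → Fin n → Fin 3 × Fin 2 with Compatible T t s ρ,
      ∏ j, outcomeProb ρ (s j) ≤
      ∑ s with ∀ j, traceNorm (reduced (S j) ρ - reduced (S j) (τ s)) < ε,
        ∏ j, outcomeProb ρ (s j) :=
    Finset.sum_le_sum_of_subset_of_nonneg (Finset.monotone_filter_right _ fun s _ => hgood s)
      fun s _ _ => hw s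
  linarith

/-- For large `ε` any guess is good enough. -/
theorem pauliSolvable_zero (hS : ∀ j, (S j).card ≤ k) (hδ : 0 ≤ δ) (hε : 2 * √(10 ^ k) < ε) :
    PauliSolvable S ε δ 0 := by
  obtain ⟨τ, hτ⟩ := exists_isDensity n
  refine ⟨fun _ j => reduced (S j) τ, fun _ j => hτ.reduced _, fun ρ hρ => ?_⟩
  have h : ∀ j, traceNorm (reduced (S j) ρ - reduced (S j) τ) < ε := fun j => by
    refine lt_of_le_of_lt (traceNorm_le _) (lt_of_le_of_lt ?_ hε)
    have h1 := norm_sub_le (frob (reduced (S j) ρ)) (frob (reduced (S j) τ))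
    have h2 := norm_frob_reduced_le_sqrt hρ (S j)
    have h3 := norm_frob_reduced_le_sqrt hτ (S j)
    have h4 : √((10 : ℝ) ^ (S j).card) = √(2 ^ (S j).card) * √(5 ^ (S j).card) := by
      rw [← Real.sqrt_mul (by positivity), ← mul_pow]
      norm_num
    have h5 : √((10 : ℝ) ^ (S j).card) ≤ √(10 ^ k) :=
      Real.sqrt_le_sqrt (pow_le_pow_right₀ (by norm_num) (hS j))
    have h6 : √((Fintype.card ({i // i ∈ S j} → Fin 2) : ℕ) : ℝ) = √(2 ^ (S j).card) := by
      simp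
    rw [h6, frob_sub]
    have h7 := mul_le_mul_of_nonneg_left (h1.trans (add_le_add h2 h3))
      (Real.sqrt_nonneg (2 ^ (S j).card))
    linarith
  simp only [trace_randomPauli_mul_copies hρ]
  simp [h, hδ]

theorem exists_pauliSolvable [Nonempty L] (hT : ∀ l, (T l).card ≤ k) (hS : ∀ j, ∃ l, S j ⊆ T l)
    (hε : 0 < ε) (hδ : 0 < δ) (hδ1 : δ < 1) :
    ∃ m : ℕ, (m : ℝ) ≤ 40 * (10 ^ k * Real.log (2 * Fintype.card L / δ) / ε ^ 2) ∧
      PauliSolvable S ε δ m := by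
  have hL : (1 : ℝ) ≤ Fintype.card L := by exact_mod_cast Fintype.card_pos
  have hlog : 1 / 2 ≤ Real.log (2 * Fintype.card L / δ) := by
    refine le_trans (by linarith [Real.log_two_gt_d9]) (Real.log_le_log (x := 2) (by norm_num) ?_)
    rw [le_div_iff₀ hδ]
    nlinarith
  -- For huge `ε` rounding up to one copy could exceed the bound, so zero copies are used. Otherwise
  -- `x ≥ 1 / 8`, and the ceiling costs `1 ≤ 8 * x`, whence `40 = 32 + 8`.
  rcases lt_or_ge (2 * √(10 ^ k)) ε with h | h
  · refine ⟨0, by simp only [Nat.cast_zero]; positivity, pauliSolvable_zero (fun j => ?_) hδ.le h⟩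
    obtain ⟨l, hl⟩ := hS j
    exact (Finset.card_le_card hl).trans (hT l)
  · set x := 10 ^ k * Real.log (2 * Fintype.card L / δ) / ε ^ 2 with hx
    have hε2 : ε ^ 2 ≤ 4 * 10 ^ k := by
      have := pow_le_pow_left₀ hε.le h 2
      rwa [mul_pow, Real.sq_sqrt (by positivity), show (2 : ℝ) ^ 2 = 4 by norm_num] at this
    have hx0 : 1 / 8 ≤ x := by
      rw [hx, le_div_iff₀ (by positivity)]
      nlinarith [pow_pos (show (0 : ℝ) < 10 by norm_num) k]
    refine ⟨⌈32 * x⌉₊, ?_, pauliSolvable_of_card_mul_exp_le hT hS hε ?_⟩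
    · have := Nat.ceil_lt_add_one (show 0 ≤ 32 * x by linarith)
      linarith
    · have h1 : Real.log (2 * Fintype.card L / δ) ≤ ⌈32 * x⌉₊ * ε ^ 2 / (32 * 10 ^ k) := by
        rw [le_div_iff₀ (by positivity)]
        have h2 := mul_le_mul_of_nonneg_right (Nat.le_ceil (32 * x)) (sq_nonneg ε)
        refine le_trans (le_of_eq ?_) h2
        rw [hx]
        field_simp
      have h3 := Real.exp_le_exp.mpr (neg_le_neg h1)
      rw [Real.exp_neg (Real.log _), Real.exp_log (by positivity)] at h3
      refine (mul_le_mul_of_nonneg_left (mul_le_mul_of_nonneg_left h3 zero_le_two)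
        (by positivity)).trans (le_of_eq ?_)
      field_simp

end Scheme

/-! ### Single-qubit marginals of product states. -/

section ProductStates

variable {n : ℕ}

theorem reduced_tensor (S : Finset (Fin n)) {A : Fin n → Matrix (Fin 2) (Fin 2) ℂ}
    (hA : ∀ i, (A i).trace = 1) : reduced S (tensor A) = tensor fun i : {i // i ∈ S} => A i := by
  ext a b
  simp only [reduced, Matrix.of_apply, tensor_apply, prod_mem_notMem S, glue_mem, glue_notMem]
  rw [← Finset.mul_sum, ← Fintype.piFinset_univ, ← Finset.prod_univ_sum (fun _ => Finset.univ)
    (fun (i : {i // i ∉ S}) z => A i z z)]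
  have h : ∀ i, ∑ z, A i z z = 1 := hA
  simp [h]

theorem norm_frob_tensor_sub_of_unique {ι κ : Type*} [Fintype ι] [DecidableEq ι] [Fintype κ]
    (i : ι) (hi : ∀ j, j = i) (A B : ι → Matrix κ κ ℂ) :
    ‖frob (tensor A - tensor B)‖ = ‖frob (A i - B i)‖ := by
  let u : Unique ι := { default := i, uniq := hi }
  have hprod : ∀ f : ι → ℂ, ∏ j, f j = f i := fun f =>
    Fintype.prod_eq_single i fun j hj => absurd (hi j) hj
  refine (sq_eq_sq₀ (norm_nonneg _) (norm_nonneg _)).mp ?_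
  rw [norm_frob_sq, norm_frob_sq, ← Equiv.sum_comp (Equiv.funUnique ι κ).symm]
  refine Finset.sum_congr rfl fun a _ => ?_
  rw [← Equiv.sum_comp (Equiv.funUnique ι κ).symm]
  refine Finset.sum_congr rfl fun b _ => ?_
  rw [Matrix.sub_apply, tensor_apply, tensor_apply, hprod, hprod]
  rfl

theorem norm_frob_reduced_sub {S : Finset (Fin n)} {i : Fin n} (hS : S = {i})
    {A B : Fin n → Matrix (Fin 2) (Fin 2) ℂ}
    (hA : ∀ i, (A i).trace = 1) (hB : ∀ i, (B i).trace = 1) :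
    ‖frob (reduced S (tensor A) - reduced S (tensor B))‖ = ‖frob (A i - B i)‖ := by
  rw [reduced_tensor _ hA, reduced_tensor _ hB]
  exact norm_frob_tensor_sub_of_unique (⟨i, by simp [hS]⟩ : {j // j ∈ S})
    (fun j => Subtype.ext (by simpa [hS] using j.2)) (fun j => A j) fun j => B j

end ProductStates

/-! ### From tomography to hypothesis testing. -/

section Testing

variable {n m k : ℕ} {ε δ : ℝ} {H : Type*} [Fintype H]

open Classical in
/-- A successful scheme distinguishes product states that are separated on single qubits. -/
theorem JointSolvable.exists_test (h : JointSolvable (localSets n k) ε δ m) (hk : 1 ≤ k)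
    {θ : H → Fin n → Matrix (Fin 2) (Fin 2) ℂ} (hθ : ∀ b i, IsDensity (θ b i))
    (hsep : ∀ b b', b ≠ b' → ∃ i, 2 * ε ≤ ‖frob (θ b i - θ b' i)‖) :
    ∃ F : H → CopiesOp m n, (∀ b, (F b).PosSemidef) ∧ (1 - ∑ b, F b).PosSemidef ∧
      ∀ b, 1 - δ ≤ (F b * copies m (tensor (θ b))).trace.re := by
  obtain ⟨Ω, _, E, est, hE, -, hs⟩ := h
  let G : H → Finset Ω := fun b => Finset.univ.filter fun ω =>
    ∀ j, traceNorm (reduced (localSets n k j) (tensor (θ b)) - est ω j) < ε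
  -- An outcome accepted for two hypotheses would give one estimate within `ε` of two marginals that
  -- are `2 * ε` apart.
  have hdisj : ((Finset.univ : Finset H) : Set H).PairwiseDisjoint G := by
    intro b _ b' _ hb
    rw [Function.onFun, Finset.disjoint_left]
    intro ω h1 h2
    obtain ⟨i, hi⟩ := hsep b b' hb
    let j : {S : Finset (Fin n) // S.card ≤ k} := ⟨{i}, by simpa using hk⟩
    have h3 := (norm_frob_le_traceNorm _).trans_lt ((Finset.mem_filter.mp h1).2 j)
    have h4 := (norm_frob_le_traceNorm _).trans_lt ((Finset.mem_filter.mp h2).2 j)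
    rw [← norm_frob_reduced_sub (S := localSets n k j) rfl (fun i => (hθ b i).2)
      (fun i => (hθ b' i).2)] at hi
    have h5 := norm_sub_le
      (frob (reduced (localSets n k j) (tensor (θ b)) - est ω j))
      (frob (reduced (localSets n k j) (tensor (θ b')) - est ω j))
    rw [← frob_sub, sub_sub_sub_cancel_right] at h5
    linarith
  refine ⟨fun b => ∑ ω ∈ G b, E ω, fun b => Matrix.posSemidef_sum _ fun ω _ => hE.1 ω, ?_,
    fun b => ?_⟩
  · rw [← Finset.sum_biUnion hdisj, ← hE.2,
      ← Finset.sum_compl_add_sum (Finset.univ.biUnion G), add_sub_cancel_right]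
    exact Matrix.posSemidef_sum _ fun ω _ => hE.1 ω
  · rw [Finset.sum_mul, Matrix.trace_sum, Complex.re_sum]
    refine (hs _ (isDensity_tensor (hθ b))).trans (le_of_eq (Finset.sum_congr ?_ fun _ _ => rfl))
    ext ω
    simp only [G, Finset.mem_filter]

/-- Testing with no copy at all is not better than guessing. -/
theorem JointSolvable.card_mul_le_one (h : JointSolvable (localSets n k) ε δ 0) (hk : 1 ≤ k)
    {θ : H → Fin n → Matrix (Fin 2) (Fin 2) ℂ} (hθ : ∀ b i, IsDensity (θ b i))
    (hsep : ∀ b b', b ≠ b' → ∃ i, 2 * ε ≤ ‖frob (θ b i - θ b' i)‖) :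
    Fintype.card H * (1 - δ) ≤ 1 := by
  obtain ⟨F, -, hF1, hF⟩ := h.exists_test hk hθ hsep
  have h1 : ∀ b, copies 0 (tensor (θ b)) = 1 := fun b => by
    ext x y
    rw [Subsingleton.elim x y]
    simp [copies, tensor_apply]
  have h2 := (Complex.nonneg_iff.mp hF1.trace_nonneg).1
  rw [Matrix.trace_sub, Matrix.trace_sum, Complex.sub_re, Complex.re_sum] at h2
  have h3 : (1 : CopiesOp 0 n).trace.re = 1 := by simp
  have h4 : ∑ _b : H, (1 - δ) ≤ ∑ b, (F b).trace.re :=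
    Finset.sum_le_sum fun b _ => by simpa [h1] using hF b
  rw [Finset.sum_const, Finset.card_univ, nsmul_eq_mul] at h4
  linarith

/-- The distribution of a bit with bias `β`. -/
def coin (β : ℝ) (a : Fin 2) : ℝ := ![(1 + β) / 2, (1 - β) / 2] a

theorem coin_nonneg {β : ℝ} (hβ : |β| ≤ 1) (a : Fin 2) : 0 ≤ coin β a := by
  obtain ⟨h1, h2⟩ := abs_le.mp hβ
  fin_cases a <;> simp [coin] <;> linarith

theorem sum_coin (β : ℝ) : ∑ a, coin β a = 1 := by
  simp [coin, Fin.sum_univ_two]; ring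

/-- The diagonal qubit state with bias `β`. -/
def coinState (β : ℝ) : Matrix (Fin 2) (Fin 2) ℂ := Matrix.diagonal fun a => (coin β a : ℂ)

theorem isDensity_coinState {β : ℝ} (hβ : |β| ≤ 1) : IsDensity (coinState β) := by
  refine ⟨Matrix.PosSemidef.diagonal fun a => ?_, ?_⟩
  · exact Complex.zero_le_real.mpr (coin_nonneg hβ a)
  · rw [coinState, Matrix.trace_diagonal, ← Complex.ofReal_sum, sum_coin, Complex.ofReal_one]

theorem norm_frob_coinState_sub_sq (β γ : ℝ) :
    ‖frob (coinState β - coinState γ)‖ ^ 2 = (β - γ) ^ 2 / 2 := by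
  rw [norm_frob_sq]
  simp only [Fin.sum_univ_two, coinState, coin, Matrix.sub_apply]
  simp only [Matrix.diagonal_apply_eq, ne_eq, Fin.isValue, zero_ne_one, not_false_eq_true,
    one_ne_zero, Matrix.diagonal_apply_ne, sub_zero, norm_zero, ← Complex.ofReal_sub,
    Complex.norm_real, Real.norm_eq_abs, sq_abs]
  simp
  ring

theorem le_norm_frob_coinState_sub {β γ r : ℝ} (hr : 2 * r ^ 2 ≤ (β - γ) ^ 2) :
    r ≤ ‖frob (coinState β - coinState γ)‖ := by
  refine le_of_sq_le_sq ?_ (norm_nonneg _)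
  rw [norm_frob_coinState_sub_sq]
  linarith

/-- The probability of the bits `x` under the biases `β i`. -/
def coinsProb (β : Fin n → ℝ) (x : Fin m → Fin n → Fin 2) : ℝ := ∏ j, ∏ i, coin (β i) (x j i)

theorem coinsProb_nonneg {β : Fin n → ℝ} (hβ : ∀ i, |β i| ≤ 1) (x : Fin m → Fin n → Fin 2) :
    0 ≤ coinsProb β x :=
  Finset.prod_nonneg fun _ _ => Finset.prod_nonneg fun i _ => coin_nonneg (hβ i) _

theorem copies_coinState (β : Fin n → ℝ) :
    copies m (tensor fun i => coinState (β i)) =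
      Matrix.diagonal fun x => (coinsProb β x : ℂ) := by
  ext x y
  rw [Matrix.diagonal_apply]
  split_ifs with h
  · subst h
    simp [copies, tensor_apply, coinState, coinsProb]
  · obtain ⟨j, hj⟩ := Function.ne_iff.mp h
    obtain ⟨i, hi⟩ := Function.ne_iff.mp hj
    rw [copies, tensor_apply]
    refine Finset.prod_eq_zero (Finset.mem_univ j) ?_
    rw [tensor_apply]
    exact Finset.prod_eq_zero (Finset.mem_univ i) (Matrix.diagonal_apply_ne _ hi)

/-- A successful scheme yields a randomized test between separated product distributions. -/
theorem JointSolvable.exists_classical_test (h : JointSolvable (localSets n k) ε δ m) (hk : 1 ≤ k)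
    {β : H → Fin n → ℝ} (hβ : ∀ b i, |β b i| ≤ 1)
    (hsep : ∀ b b', b ≠ b' → ∃ i, 8 * ε ^ 2 ≤ (β b i - β b' i) ^ 2) :
    ∃ f : H → (Fin m → Fin n → Fin 2) → ℝ, (∀ b x, 0 ≤ f b x) ∧ (∀ x, ∑ b, f b x ≤ 1) ∧
      ∀ b, 1 - δ ≤ ∑ x, f b x * coinsProb (β b) x := by
  obtain ⟨F, hF0, hF1, hF⟩ := h.exists_test hk (θ := fun b i => coinState (β b i))
    (fun b i => isDensity_coinState (hβ b i)) fun b b' hb => by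
      obtain ⟨i, hi⟩ := hsep b b' hb
      exact ⟨i, le_norm_frob_coinState_sub (by linarith)⟩
  -- The states are diagonal, so only the diagonal of each effect matters.
  refine ⟨fun b x => (F b x x).re, fun b x => (Complex.nonneg_iff.mp (hF0 b).diag_nonneg).1,
    fun x => ?_, fun b => (hF b).trans (le_of_eq ?_)⟩
  · have := (Complex.nonneg_iff.mp (hF1.diag_nonneg (i := x))).1
    simp only [Matrix.sub_apply, Matrix.one_apply_eq, Matrix.sum_apply, Complex.sub_re,
      Complex.one_re, Complex.re_sum] at this
    linarith
  · rw [copies_coinState, Matrix.trace, Complex.re_sum]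
    simp [Matrix.mul_diagonal]

end Testing

/-! ### Lower bound from `2 ^ n` bias patterns. -/

section ManyHypotheses

variable {n m k : ℕ} {ε δ : ℝ}

theorem sum_prod_coin (β : ℝ) (m : ℕ) : ∑ y : Fin m → Fin 2, ∏ j, coin β (y j) = 1 := by
  rw [← Fintype.piFinset_univ, ← Finset.prod_univ_sum (fun _ => Finset.univ)
    (fun (_ : Fin m) a => coin β a)]
  simp only [sum_coin, Finset.prod_const_one]

theorem coin_mul_coin_neg (α : ℝ) (a : Fin 2) : coin α a * coin (-α) a = (1 - α ^ 2) / 4 := by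
  fin_cases a <;> simp [coin] <;> ring

/-- Two opposite biases cannot be told apart well from `m` tosses. -/
theorem sum_max_coin_le {α : ℝ} (hα : |α| ≤ 1) (m : ℕ) :
    ∑ y : Fin m → Fin 2, max (∏ j, coin α (y j)) (∏ j, coin (-α) (y j)) ≤
      2 - (1 - α ^ 2) ^ m / 2 := by
  set P : (Fin m → Fin 2) → ℝ := fun y => ∏ j, coin α (y j) with hP
  set Q : (Fin m → Fin 2) → ℝ := fun y => ∏ j, coin (-α) (y j) with hQ
  have hP0 : ∀ y, 0 ≤ P y := fun y => Finset.prod_nonneg fun j _ => coin_nonneg hα _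
  have hQ0 : ∀ y, 0 ≤ Q y := fun y => Finset.prod_nonneg fun j _ =>
    coin_nonneg (by rwa [abs_neg]) _
  have hα2 : 0 ≤ 1 - α ^ 2 := by
    have := (sq_le_one_iff_abs_le_one α).mpr hα
    linarith
  -- The product does not depend on `y`, so Cauchy–Schwarz on `min * max = P * Q` gives `(1 - α ^ 2)
  -- ^ m ≤ (∑ min) * (∑ max)`, while the two sums add up to `2`.
  have hPQ : ∀ y, P y * Q y = ((√(1 - α ^ 2) / 2) ^ m) ^ 2 := fun y => by
    simp only [hP, hQ, ← Finset.prod_mul_distrib, coin_mul_coin_neg]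
    rw [Finset.prod_const, Finset.card_univ, Fintype.card_fin, ← pow_mul, mul_comm m 2, pow_mul,
      div_pow (√(1 - α ^ 2)) 2 2, Real.sq_sqrt hα2]
    norm_num
  have hsum : ∑ y, min (P y) (Q y) + ∑ y, max (P y) (Q y) = 2 := by
    rw [← Finset.sum_add_distrib]
    simp only [min_add_max]
    rw [Finset.sum_add_distrib, sum_prod_coin, sum_prod_coin]
    norm_num
  have hmin0 : 0 ≤ ∑ y, min (P y) (Q y) :=
    Finset.sum_nonneg fun y _ => le_min (hP0 y) (hQ0 y)
  have hcs := Finset.sum_sq_le_sum_mul_sum_of_sq_le_mul Finset.univ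
    (r := fun _ : Fin m → Fin 2 => (√(1 - α ^ 2) / 2) ^ m)
    (f := fun y => min (P y) (Q y)) (g := fun y => max (P y) (Q y))
    (fun y _ => le_min (hP0 y) (hQ0 y)) (fun y _ => le_max_of_le_left (hP0 y))
    (fun y _ => by rw [min_mul_max, hPQ])
  have hK : (∑ _y : Fin m → Fin 2, (√(1 - α ^ 2) / 2) ^ m) ^ 2 = (1 - α ^ 2) ^ m := by
    rw [Finset.sum_const, Finset.card_univ, nsmul_eq_mul, Fintype.card_fun, Fintype.card_fin,
      Fintype.card_fin]
    push_cast
    rw [← mul_pow, mul_div_cancel₀ _ (two_ne_zero), ← pow_mul, mul_comm m 2, pow_mul,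
      Real.sq_sqrt hα2]
  rw [hK] at hcs
  nlinarith

/-- The total success probability of a test is at most the sum over outcomes of the largest
likelihood, and for product hypotheses this sum factorises over qubits. -/
theorem two_pow_mul_le (h : JointSolvable (localSets n k) ε δ m) (hk : 1 ≤ k) (hε : 0 < ε)
    (hε2 : ε ≤ 1 / 2) : 2 ^ n * (1 - δ) ≤ (2 - (1 - 2 * ε ^ 2) ^ m / 2) ^ n := by
  -- The biases `±α` then satisfy `(2 * α) ^ 2 = 8 * ε ^ 2`, exactly the separation required.
  set α := √2 * ε with hα
  have hα2 : α ^ 2 = 2 * ε ^ 2 := by rw [hα, mul_pow, Real.sq_sqrt zero_le_two]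
  have hα1 : |α| ≤ 1 := by
    rw [← sq_le_one_iff_abs_le_one, hα2]
    nlinarith
  have hβ : ∀ s : Bool, |bif s then α else -α| ≤ 1 := fun s => by cases s <;> simpa using hα1
  obtain ⟨f, hf0, hf1, hf⟩ := h.exists_classical_test hk
    (β := fun (b : Fin n → Bool) i => bif b i then α else -α) (fun b i => hβ _)
    (fun b b' hb => by
      obtain ⟨i, hi⟩ := Function.ne_iff.mp hb
      refine ⟨i, ?_⟩
      rcases hb1 : b i <;> rcases hb2 : b' i <;> simp [hb1, hb2] at hi ⊢ <;> nlinarith)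
  let g : (Fin m → Fin 2) → ℝ := fun y => max (∏ j, coin α (y j)) (∏ j, coin (-α) (y j))
  have hle : ∀ (b : Fin n → Bool) (x : Fin m → Fin n → Fin 2),
      coinsProb (fun i => bif b i then α else -α) x ≤ ∏ i, g fun j => x j i := fun b x => by
    rw [coinsProb, Finset.prod_comm]
    refine Finset.prod_le_prod
      (fun i _ => Finset.prod_nonneg fun j _ => coin_nonneg (hβ _) _) fun i _ => ?_
    cases b i
    · exact le_max_right _ _
    · exact le_max_left _ _
  have hg0 : ∀ x : Fin m → Fin n → Fin 2, 0 ≤ ∏ i, g fun j => x j i := fun x =>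
    Finset.prod_nonneg fun i _ =>
      le_max_of_le_left (Finset.prod_nonneg fun j _ => coin_nonneg hα1 _)
  have hsum : ∑ x : Fin m → Fin n → Fin 2, ∏ i, g (fun j => x j i) = (∑ y, g y) ^ n := by
    rw [Fintype.sum_pow]
    exact Equiv.sum_comp (Equiv.piComm fun (_ : Fin m) (_ : Fin n) => Fin 2)
      fun y => ∏ i, g (y i)
  calc (2 : ℝ) ^ n * (1 - δ) = ∑ _b : Fin n → Bool, (1 - δ) := by
        rw [Finset.sum_const, Finset.card_univ, nsmul_eq_mul]
        simp
    _ ≤ ∑ b : Fin n → Bool, ∑ x, f b x * coinsProb (fun i => bif b i then α else -α) x :=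
        Finset.sum_le_sum fun b _ => hf b
    _ ≤ ∑ b : Fin n → Bool, ∑ x, f b x * ∏ i, g fun j => x j i :=
        Finset.sum_le_sum fun b _ => Finset.sum_le_sum fun x _ =>
          mul_le_mul_of_nonneg_left (hle b x) (hf0 b x)
    _ = ∑ x, (∑ b, f b x) * ∏ i, g fun j => x j i := by
        rw [Finset.sum_comm]
        simp only [Finset.sum_mul]
    _ ≤ ∑ x : Fin m → Fin n → Fin 2, ∏ i, g fun j => x j i :=
        Finset.sum_le_sum fun x _ => mul_le_of_le_one_left (hg0 x) (hf1 x)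
    _ = (∑ y, g y) ^ n := hsum
    _ ≤ _ := by
        refine pow_le_pow_left₀ (Finset.sum_nonneg fun y _ => le_max_of_le_left
          (Finset.prod_nonneg fun j _ => coin_nonneg hα1 _)) ?_ n
        rw [← hα2]
        exact sum_max_coin_le hα1 m

theorem log_le_of_jointSolvable (h : JointSolvable (localSets n k) ε δ m) (hk : 1 ≤ k)
    (hn : 1 ≤ n) (hε : 0 < ε) (hε2 : ε ≤ 1 / 2) (hδ : 0 < δ) (hδ2 : δ ≤ 1 / 2) :
    Real.log (n / δ) ≤ 4 * ε ^ 2 * m + Real.log 8 := by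
  have hn0 : (0 : ℝ) < n := by exact_mod_cast hn
  have hε4 : ε ^ 2 ≤ 1 / 4 := by nlinarith
  set q := (1 - 2 * ε ^ 2) ^ m with hq
  have hq1 : q ≤ 1 := pow_le_one₀ (by nlinarith) (by nlinarith)
  have h1 := two_pow_mul_le h hk hε hε2
  have h2 : (2 - q / 2) ^ n ≤ 2 ^ n * Real.exp (-(n * (q / 4))) := by
    rw [← mul_neg, Real.exp_nat_mul, ← mul_pow]
    refine pow_le_pow_left₀ (by linarith) ?_ n
    have := Real.add_one_le_exp (-(q / 4))
    linarith
  have h3 : 1 - δ ≤ Real.exp (-(n * (q / 4))) :=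
    le_of_mul_le_mul_left (h1.trans h2) (by positivity)
  -- Uses `1 / (1 - δ) ≤ 1 + 2 * δ` for `δ ≤ 1 / 2`.
  have h4 : n * q ≤ 8 * δ := by
    have h5 := Real.add_one_le_exp (n * (q / 4))
    rw [Real.exp_neg, ← one_div, le_div_iff₀ (Real.exp_pos _)] at h3
    nlinarith
  -- Amounts to `(1 - 2 * u) * (1 + 4 * u) ≥ 1` for `u = ε ^ 2 ≤ 1 / 4`.
  have h6 : Real.exp (-(4 * ε ^ 2 * m)) ≤ q := by
    rw [hq, show -(4 * ε ^ 2 * m) = m * (-(4 * ε ^ 2)) by ring, Real.exp_nat_mul]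
    refine pow_le_pow_left₀ (Real.exp_pos _).le ?_ m
    rw [Real.exp_neg, inv_le_comm₀ (Real.exp_pos _) (by nlinarith)]
    refine le_trans ?_ (Real.add_one_le_exp (4 * ε ^ 2))
    rw [inv_le_iff_one_le_mul₀ (by nlinarith)]
    nlinarith [sq_nonneg ε]
  rw [← Real.log_exp (4 * ε ^ 2 * m), ← Real.log_mul (Real.exp_pos _).ne' (by norm_num)]
  refine Real.log_le_log (by positivity) ?_
  rw [div_le_iff₀ hδ]
  rw [Real.exp_neg, inv_le_iff_one_le_mul₀ (Real.exp_pos _)] at h6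
  nlinarith [Real.exp_pos (4 * ε ^ 2 * m)]

end ManyHypotheses

/-! ### Lower bounds for bounded `n / δ`, from three hypotheses. -/

section ThreeHypotheses

variable {n m k : ℕ} {ε δ : ℝ}

theorem sum_coinsProb (β : Fin n → ℝ) : ∑ x : Fin m → Fin n → Fin 2, coinsProb β x = 1 := by
  have h := copies_coinState (m := m) β
  have h2 := congrArg Matrix.trace h
  rw [copies, trace_tensor, trace_tensor, Matrix.trace_diagonal, ← Complex.ofReal_sum] at h2
  have h3 : ∀ i, (coinState (β i)).trace = 1 := fun i => by
    rw [coinState, Matrix.trace_diagonal, ← Complex.ofReal_sum, sum_coin, Complex.ofReal_one]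
  simp only [h3, Finset.prod_const_one] at h2
  exact_mod_cast h2.symm

theorem coinsProb_zero (x : Fin m → Fin n → Fin 2) :
    coinsProb (fun _ => 0) x = ((1 / 2) ^ n) ^ m := by
  have : ∀ a, coin 0 a = 1 / 2 := fun a => by fin_cases a <;> simp [coin]
  simp [coinsProb, this]

theorem sum_coinsProb_sq (β : ℝ) :
    ∑ x : Fin m → Fin n → Fin 2, coinsProb (fun _ => β) x ^ 2 = (((1 + β ^ 2) / 2) ^ n) ^ m := by
  have h : ∑ a, coin β a ^ 2 = (1 + β ^ 2) / 2 := by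
    simp [coin, Fin.sum_univ_two]; ring
  rw [← h, Fintype.sum_pow, Fintype.sum_pow]
  simp only [coinsProb, Finset.prod_pow]

/-- Cauchy–Schwarz against the uniform distribution; the right side is the chi-square divergence. -/
theorem sum_abs_coinsProb_sub_sq_le (β : ℝ) :
    (∑ x : Fin m → Fin n → Fin 2, |coinsProb (fun _ => β) x - coinsProb (fun _ => 0) x|) ^ 2 ≤
      (1 + β ^ 2) ^ (n * m) - 1 := by
  refine (sq_sum_le_card_mul_sum_sq (s := Finset.univ)).trans (le_of_eq ?_)
  set q : ℝ := ((1 / 2) ^ n) ^ m with hq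
  have hN : (Fintype.card (Fin m → Fin n → Fin 2) : ℝ) * q = 1 := by
    rw [hq]
    simp only [Fintype.card_fun, Fintype.card_fin]
    push_cast
    rw [← mul_pow, ← mul_pow]
    norm_num
  have hexp : ∀ x : Fin m → Fin n → Fin 2,
      |coinsProb (fun _ => β) x - coinsProb (fun _ => 0) x| ^ 2 =
        coinsProb (fun _ => β) x ^ 2 - 2 * q * coinsProb (fun _ => β) x + q * q := fun x => by
    rw [sq_abs, coinsProb_zero]
    ring
  simp only [hexp]
  rw [Finset.sum_add_distrib, Finset.sum_sub_distrib, ← Finset.mul_sum, sum_coinsProb,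
    sum_coinsProb_sq, Finset.sum_const, Finset.card_univ, nsmul_eq_mul]
  have h2 : (((1 + β ^ 2) / 2) ^ n) ^ m = (1 + β ^ 2) ^ (n * m) * q := by
    rw [hq, ← pow_mul, ← pow_mul, ← mul_pow]
    ring
  rw [h2]
  linear_combination ((1 + β ^ 2) ^ (n * m) +
    (Fintype.card (Fin m → Fin n → Fin 2) : ℝ) * q - 1) * hN

theorem one_le_mul_of_jointSolvable (h : JointSolvable (localSets n k) ε δ m) (hk : 1 ≤ k)
    (hn : 1 ≤ n) (hε : 0 < ε) (hε2 : ε ≤ 1 / 8) (hδ2 : δ ≤ 1 / 2) :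
    1 ≤ 136 * ε ^ 2 * (n * m) := by
  set α := √8 * ε with hα
  have hα2 : α ^ 2 = 8 * ε ^ 2 := by rw [hα, mul_pow, Real.sq_sqrt (by norm_num)]
  have hα1 : |α| ≤ 1 := by
    rw [← sq_le_one_iff_abs_le_one, hα2]
    nlinarith
  obtain ⟨f, hf0, hf1, hf⟩ := h.exists_classical_test hk
    (β := fun (b : Fin 3) _ => ![0, α, -α] b)
    (fun b i => by fin_cases b <;> simp [hα1])
    (fun b b' hb => by
      refine ⟨⟨0, hn⟩, ?_⟩
      rw [← hα2]
      fin_cases b <;> fin_cases b' <;> simp at hb ⊢ <;> nlinarith [sq_nonneg α])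
  have h0 := hf 0
  have h1 := hf 1
  have h2 := hf 2
  simp only [Matrix.cons_val_zero, Matrix.cons_val_one, Matrix.cons_val_two, Matrix.head_cons,
    Matrix.tail_cons] at h0 h1 h2
  set D := √((1 + α ^ 2) ^ (n * m) - 1) with hD
  have hf1' : ∀ b x, f b x ≤ 1 := fun b x =>
    (Finset.single_le_sum (fun b _ => hf0 b x) (Finset.mem_univ b)).trans (hf1 x)
  have hbd : ∀ (b : Fin 3) (β : ℝ), β ^ 2 = α ^ 2 → ∑ x, f b x * coinsProb (fun _ => β) x ≤
      ∑ x, f b x * coinsProb (fun _ => 0) x + D := fun b β hβ => by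
    have h3 := sum_abs_coinsProb_sub_sq_le (m := m) (n := n) β
    rw [hβ] at h3
    refine le_trans ?_ (add_le_add_right (Real.le_sqrt_of_sq_le h3) _)
    rw [← Finset.sum_add_distrib]
    refine Finset.sum_le_sum fun x _ => ?_
    have h4 := le_abs_self (coinsProb (fun _ => β) x - coinsProb (fun _ : Fin n => 0) x)
    have h5 := abs_nonneg (coinsProb (fun _ => β) x - coinsProb (fun _ : Fin n => 0) x)
    nlinarith [hf0 b x, hf1' b x]
  have h3 : ∑ b, ∑ x, f b x * coinsProb (fun _ => 0) x ≤ 1 := by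
    rw [Finset.sum_comm]
    simp only [← Finset.sum_mul]
    rw [← sum_coinsProb (m := m) (fun _ : Fin n => 0)]
    exact Finset.sum_le_sum fun x _ =>
      mul_le_of_le_one_left (coinsProb_nonneg (by simp) x) (hf1 x)
  rw [Fin.sum_univ_three] at h3
  -- Three success probabilities of at least `1 / 2` are compared with a total of at most `1` under
  -- the unbiased law: `3 / 2 ≤ 1 + 2 * D`.
  have hD4 : 1 / 4 ≤ D := by
    linarith [hbd 1 α rfl, hbd 2 (-α) (by ring)]
  have h6 : (17 : ℝ) / 16 ≤ (1 + α ^ 2) ^ (n * m) := by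
    have := (Real.le_sqrt' (by norm_num)).mp hD4
    linarith
  have h7 : (1 + α ^ 2) ^ (n * m) ≤ Real.exp ((n * m : ℕ) * α ^ 2) := by
    rw [Real.exp_nat_mul]
    refine pow_le_pow_left₀ (by positivity) ?_ _
    linarith [Real.add_one_le_exp (α ^ 2)]
  have h9 : (1 : ℝ) / 17 ≤ (n * m : ℕ) * α ^ 2 := by
    have h10 := Real.one_sub_inv_le_log_of_pos (show (0 : ℝ) < 17 / 16 by norm_num)
    have h11 := Real.log_le_log (by norm_num) (h6.trans h7)
    rw [Real.log_exp] at h11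
    norm_num at h10
    linarith
  rw [hα2] at h9
  push_cast at h9
  linarith

theorem pos_of_jointSolvable (h : JointSolvable (localSets n k) ε δ m) (hk : 1 ≤ k)
    (hn : 1 ≤ n) (hε : 0 < ε) (hε2 : ε ≤ 1 / 2) (hδ2 : δ ≤ 1 / 2) : 0 < m := by
  rcases Nat.eq_zero_or_pos m with rfl | hm
  swap
  · exact hm
  exfalso
  let P : Matrix (Fin 2) (Fin 2) ℂ := !![1 / 2, 1 / 2; 1 / 2, 1 / 2]
  have hP : IsDensity P := by
    have : P = P.conjTranspose * P := by
      ext x y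
      fin_cases x <;> fin_cases y <;>
        simp [P, Matrix.mul_apply, Fin.sum_univ_two, Matrix.conjTranspose_apply, map_ofNat] <;>
        norm_num
    refine ⟨?_, ?_⟩
    · rw [this]
      exact Matrix.posSemidef_conjTranspose_mul_self _
    · simp [P, Matrix.trace, Fin.sum_univ_two]
      norm_num
  -- The separation must reach `2 * ε = 1` at `ε = 1 / 2`. Three diagonal qubit states cannot be
  -- that far apart pairwise, hence the off-diagonal `P`.
  let θ : Fin 3 → Matrix (Fin 2) (Fin 2) ℂ := ![coinState 1, coinState (-1), P]
  have hθ : ∀ b, IsDensity (θ b) := fun b => by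
    fin_cases b
    · exact isDensity_coinState (by simp)
    · exact isDensity_coinState (by simp)
    · exact hP
  have hd : ∀ b b', b ≠ b' → 1 ≤ ‖frob (θ b - θ b')‖ := fun b b' hb => by
    refine le_of_sq_le_sq ?_ (norm_nonneg _)
    rw [norm_frob_sq]
    fin_cases b <;> fin_cases b' <;> simp at hb <;>
      simp [θ, P, coinState, coin, Fin.sum_univ_two, Matrix.sub_apply,
        ← Complex.normSq_eq_norm_sq, Complex.normSq_apply] <;>
      norm_num
  have := h.card_mul_le_one hk (θ := fun b _ => θ b) (fun b _ => hθ b)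
    fun b b' hb => ⟨⟨0, hn⟩, by linarith [hd b b' hb]⟩
  simp only [Fintype.card_fin] at this
  norm_num at this
  linarith

end ThreeHypotheses

/-! ### Assembling the bounds. -/

/-- The sample complexity lower bound, for arbitrary joint measurements. -/
theorem log_div_sq_le_of_jointSolvable {n m k : ℕ} {ε δ : ℝ}
    (h : JointSolvable (localSets n k) ε δ m) (hk : 1 ≤ k)
    (hn : 1 ≤ n) (hε : 0 < ε) (hε2 : ε ≤ 1 / 2) (hδ : 0 < δ) (hδ2 : δ ≤ 1 / 2) :
    1 / 20000 * (Real.log (n / δ) / ε ^ 2) ≤ m := by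
  have hn0 : (1 : ℝ) ≤ n := by exact_mod_cast hn
  have hm0 : (0 : ℝ) ≤ m := Nat.cast_nonneg m
  have hl2 := Real.log_two_lt_d9
  rw [← mul_div_assoc, div_le_iff₀ (by positivity)]
  have hl8 : Real.log 8 = 3 * Real.log 2 := by
    rw [show (8 : ℝ) = 2 ^ 3 by norm_num, Real.log_pow]; norm_num
  have hl64 : Real.log 64 = 6 * Real.log 2 := by
    rw [show (64 : ℝ) = 2 ^ 6 by norm_num, Real.log_pow]; norm_num
  -- From `64 = 8 ^ 2` on, `log 8` is at most half of `log (n / δ)`. Below, `n ≤ 32` and the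
  -- logarithm is bounded; the case `ε ≤ 1 / 8` dictates the constant, since `136 * 32 * log 64 <
  -- 20000`.
  rcases le_or_gt 64 (n / δ) with hbig | hsmall
  · have h1 := log_le_of_jointSolvable h hk hn hε hε2 hδ hδ2
    have h2 := Real.log_le_log (by norm_num) hbig
    nlinarith [mul_nonneg hm0 (sq_nonneg ε)]
  · have h1 := Real.log_le_log (by positivity) hsmall.le
    rcases le_or_gt ε (1 / 8) with hs | hs
    · have h2 := one_le_mul_of_jointSolvable h hk hn hε hs hδ2
      have h3 : (n : ℝ) ≤ 32 := by
        rw [div_lt_iff₀ hδ] at hsmall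
        linarith
      have h4 : ε ^ 2 * (n * m) ≤ 32 * (m * ε ^ 2) := by
        nlinarith [mul_nonneg hm0 (sq_nonneg ε)]
      nlinarith
    · have h2 : (1 : ℝ) ≤ m := by exact_mod_cast pos_of_jointSolvable h hk hn hε hε2 hδ2
      nlinarith

theorem exists_pauliSolvable_localSets {n k : ℕ} {ε δ : ℝ} (hk : 1 ≤ k) (hkn : k ≤ n) (hε : 0 < ε)
    (hδ : 0 < δ) (hδ1 : δ < 1) (hδ2 : k = n → δ ≤ 1 / 2) :
    ∃ m : ℕ, (m : ℝ) ≤ 80 * (10 ^ k * Real.log (n.choose k / δ) / ε ^ 2) ∧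
      PauliSolvable (localSets n k) ε δ m := by
  have hcard : Fintype.card {T : Finset (Fin n) // T.card = k} = n.choose k := by
    rw [Fintype.card_finset_len, Fintype.card_fin]
  have hpos : 0 < n.choose k := Nat.choose_pos hkn
  have : Nonempty {T : Finset (Fin n) // T.card = k} :=
    Fintype.card_pos_iff.mp (hcard ▸ hpos)
  obtain ⟨m, hm, hs⟩ := exists_pauliSolvable (L := {T : Finset (Fin n) // T.card = k})
    (T := Subtype.val) (S := localSets n k) (fun l => l.2.le)
    (fun j => by
      obtain ⟨T, hT, hTk⟩ := Finset.exists_superset_card_eq j.2 (by simpa using hkn)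
      exact ⟨⟨T, hTk⟩, hT⟩) hε hδ hδ1
  refine ⟨m, hm.trans ?_, hs⟩
  rw [hcard]
  have hpos' : (0 : ℝ) < n.choose k := by exact_mod_cast hpos
  -- This absorbs the `2` inside the logarithm, doubling the constant `40`. For `k = n` the binomial
  -- is `1`, which is where `δ ≤ 1 / 2` enters.
  have h2 : 2 ≤ (n.choose k : ℝ) / δ := by
    rw [le_div_iff₀ hδ]
    rcases hkn.eq_or_lt with h | h
    · have h3 : (1 : ℝ) ≤ n.choose k := by exact_mod_cast hpos
      linarith [hδ2 h]
    · have h3 : 2 ≤ n.choose k := by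
        have h4 : n.choose k ≠ 1 := fun h' => by
          rcases Nat.choose_eq_one_iff.mp h' with h' | h' <;> omega
        omega
      have h4 : (2 : ℝ) ≤ n.choose k := by exact_mod_cast h3
      linarith
  have hlog : Real.log (2 * n.choose k / δ) ≤ 2 * Real.log (n.choose k / δ) := by
    rw [mul_div_assoc, Real.log_mul two_ne_zero (by positivity)]
    linarith [Real.log_le_log two_pos h2]
  calc 40 * (10 ^ k * Real.log (2 * n.choose k / δ) / ε ^ 2)
      ≤ 40 * (10 ^ k * (2 * Real.log (n.choose k / δ)) / ε ^ 2) := by gcongr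
    _ = _ := by ring

theorem log_choose_div_le {n k : ℕ} {δ : ℝ} (hk : 1 ≤ k) (hkn : k ≤ n) (hδ : 0 < δ)
    (hδ1 : δ ≤ 1) : Real.log (n.choose k / δ) ≤ k * Real.log (n / δ) := by
  have hn : (1 : ℝ) ≤ n := by exact_mod_cast hk.trans hkn
  have hc : (0 : ℝ) < n.choose k := by exact_mod_cast Nat.choose_pos hkn
  rw [← Real.log_pow]
  refine Real.log_le_log (by positivity) ?_
  rw [div_pow]
  have h1 : (n.choose k : ℝ) ≤ (n : ℝ) ^ k := by exact_mod_cast Nat.choose_le_pow n k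
  have h2 : δ ^ k ≤ δ := pow_le_of_le_one hδ.le hδ1 (by omega)
  exact div_le_div₀ (by positivity) h1 (by positivity) h2

end OverlappingTomography

end

open OverlappingTomography in
theorem theorem2 :
    -- constant `k`: the sample complexity is `Θ(ε⁻² log (n / δ))`, with joint measurements
    -- as well as with Pauli measurements
    (∃ c : ℝ, 0 < c ∧ ∀ k : ℕ, 1 ≤ k → ∃ C : ℝ, 0 < C ∧
      ∀ (n : ℕ) (ε δ : ℝ), k ≤ n → 0 < ε → ε ≤ 1 / 2 → 0 < δ → δ ≤ 1 / 2 →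
        ∃ mJoint mPauli : ℕ,
          IsLeast {m : ℕ | JointSolvable (localSets n k) ε δ m} mJoint ∧
          IsLeast {m : ℕ | PauliSolvable (localSets n k) ε δ m} mPauli ∧
          c * (Real.log (n / δ) / ε ^ 2) ≤ mJoint ∧
          mJoint ≤ mPauli ∧
          mPauli ≤ C * (Real.log (n / δ) / ε ^ 2)) ∧
    -- general `1 ≤ k ≤ n`
    (∃ C : ℝ, 0 < C ∧
      ∀ (n k : ℕ) (ε δ : ℝ), 1 ≤ k → k ≤ n → 0 < ε → 0 < δ → δ < 1 → (k = n → δ ≤ 1 / 2) →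
        ∃ m : ℕ, (m : ℝ) ≤ C * (10 ^ k * Real.log (n.choose k / δ) / ε ^ 2) ∧
          PauliSolvable (localSets n k) ε δ m) ∧
    -- `M` prescribed subsets of at most `k` qubits
    (∃ C : ℝ, 0 < C ∧
      ∀ (n k M : ℕ) (S : Fin M → Finset (Fin n)) (ε δ : ℝ), 1 ≤ k → k ≤ n → 1 ≤ M →
        (∀ i, (S i).card ≤ k) → 0 < ε → 0 < δ → δ < 1 →
        ∃ m : ℕ, (m : ℝ) ≤ C * (10 ^ k * Real.log (2 * M / δ) / ε ^ 2) ∧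
          PauliSolvable S ε δ m) := by
  classical
  refine ⟨⟨1 / 20000, by norm_num, fun k hk => ⟨80 * 10 ^ k * k, by positivity,
    fun n ε δ hkn hε hε2 hδ hδ2 => ?_⟩⟩, ⟨80, by norm_num,
    fun n k ε δ hk hkn hε hδ hδ1 hδ2 =>
      exists_pauliSolvable_localSets hk hkn hε hδ hδ1 hδ2⟩, ⟨40, by norm_num,
    fun n k M S ε δ hk hkn hM hS hε hδ hδ1 => ?_⟩⟩
  · obtain ⟨m, hm, hs⟩ := exists_pauliSolvable_localSets hk hkn hε hδ (by linarith) fun _ => hδ2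
    have hP : ∃ m, PauliSolvable (localSets n k) ε δ m := ⟨m, hs⟩
    have hJ : ∃ m, JointSolvable (localSets n k) ε δ m := ⟨m, hs.jointSolvable⟩
    refine ⟨Nat.find hJ, Nat.find hP, ⟨Nat.find_spec hJ, fun _ h => Nat.find_min' hJ h⟩,
      ⟨Nat.find_spec hP, fun _ h => Nat.find_min' hP h⟩,
      log_div_sq_le_of_jointSolvable (Nat.find_spec hJ) hk (hk.trans hkn) hε hε2 hδ hδ2,
      Nat.find_min' hJ (Nat.find_spec hP).jointSolvable, ?_⟩
    have h1 : (Nat.find hP : ℝ) ≤ m := by exact_mod_cast Nat.find_min' hP hs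
    refine (h1.trans hm).trans ?_
    calc 80 * (10 ^ k * Real.log (n.choose k / δ) / ε ^ 2)
        ≤ 80 * (10 ^ k * (k * Real.log (n / δ)) / ε ^ 2) := by
          gcongr
          exact log_choose_div_le hk hkn hδ (by linarith)
      _ = 80 * 10 ^ k * k * (Real.log (n / δ) / ε ^ 2) := by ring
  · have : Nonempty (Fin M) := ⟨⟨0, hM⟩⟩
    have h := exists_pauliSolvable (L := Fin M) (T := S) (S := S) hS
      (fun j => ⟨j, Finset.Subset.refl _⟩) hε hδ hδ1
    simpa only [Fintype.card_fin] using h
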